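/- Let $Q=(0,1)^2$, let $f_1,f_2:\mathbb R^2\to(0,+\infty)$ be Lipschitz continuous and $Q$-periodic (that is, $f_i(x'+k)=f_i(x')$ for all $x'\in\mathbb R^2$, $k\in\mathbb Z^2$) with $f_1<f_2$, and let $\omega\subset\mathbb R^2$ be a bounded open set with Lipschitz boundary. Write $x=(x',x_3)\in\mathbb R^2\times\mathbb R$ and, for $\varepsilon>0$, set $$\Omega_\varepsilon=\left\{(x',x_3):\ x'\in\omega,\ f_1\left(\tfrac{x'}{\varepsilon}\right)<x_3<f_2\left(\tfrac{x'}{\varepsilon}\right)\right\},\qquad Q_{f_1,f_2}=\{(y',y_3):\ y'\in Q,\ f_1(y')<y_3<f_2(y')\}.$$ For $\xi\in\mathbb R^{3\times2}$ let $$g_{\rm hom}(\xi)=\inf_{\varphi\in H^1_\#(Q_{f_1,f_2};\mathbb R^3)}\int_{Q_{f_1,f_2}}\left(|\xi+\nabla_{y'}\varphi|^2+|\partial_{y_3}\varphi|^2\right)dy,$$ where $|\cdot|$ is the Euclidean (Frobenius) norm and $H^1_\#(Q_{f_1,f_2};\mathbb R^3)$ is the space of functions in $H^1(Q_{f_1,f_2};\mathbb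 R^3)$ that are $Q$-periodic in $y'$, i.e. whose $Q$-periodic extension in $y'$ belongs to $H^1$ of every bounded portion $\{y'\in B,\ f_1(y')<y_3<f_2(y')\}$, $B\subset\mathbb R^2$ bounded and open, of the strip between the two graphs. For an open set $U$, let $H^1(U;\mathbb S^2)$ be the set of $m\in H^1(U;\mathbb R^3)$ with $|m|=1$ a.e. in $U$. Let $m_0\in H^1(\omega;\mathbb S^2)$, and for every $\varepsilon>0$ let $m_\varepsilon\in H^1(\Omega_\varepsilon;\mathbb S^2)$ be such that $$\int_{\Omega_\varepsilon}|m_\varepsilon(x)-m_0(x')|^2\,dx\to0\qquad\text{as }\varepsilon\to0^+ .$$ Then $$\int_\omega g_{\rm hom}(\nabla m_0)\,dx'\ \le\ \liminf_{\varepsilon\to0^+}\int_{\Omega_\varepsilon}\left(|\nabla_{x'}m_\varepsilon|^2+\frac1{\varepsilon^2}|\partial_3m_\varepsilon|^2\right)dx ,$$ where the right-hand side may be $+\infty$. -/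

import Mathlib

open MeasureTheory Filter Topology
open scoped ENNReal NNReal

noncomputable section

namespace ThinFilm

/-- The plane, with its Euclidean norm and Lebesgue measure. -/
abbrev Plane : Type := EuclideanSpace ℝ (Fin 2)

/-- The space of vector values, with its Euclidean norm. -/
abbrev Vec3 : Type := EuclideanSpace ℝ (Fin 3)

/-- Points `x = (x', x₃)` of three-dimensional space, with `x'` in the plane and `x₃` real.
Only the Lebesgue (product) measure and the differentiable structure of this space are used. -/
abbrev Space : Type := Plane × ℝ

section Sobolev

variable {E F : Type*} [NormedAddCommGroup E] [NormedSpace ℝ E] [MeasureSpace E]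
  [NormedAddCommGroup F] [NormedSpace ℝ F]

/-- `w ∈ L²(U; F)` is the weak derivative of `u ∈ L²(U; F)` in the direction `v` on the
open set `U`: `∫_U (∂_v φ) u = - ∫_U φ w` for all test functions `φ ∈ C_c^∞(U)`. -/
def HasWeakDeriv (U : Set E) (u : E → F) (v : E) (w : E → F) : Prop :=
  MemLp u 2 (volume.restrict U) ∧ MemLp w 2 (volume.restrict U) ∧
    ∀ φ : E → ℝ, ContDiff ℝ (⊤ : ℕ∞) φ → HasCompactSupport φ → tsupport φ ⊆ U →
      ∫ x in U, fderiv ℝ φ x v • u x = - ∫ x in U, φ x • w x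

/-- The Sobolev space `H¹(U; F)`. -/
def MemH1 (U : Set E) (u : E → F) : Prop :=
  MemLp u 2 (volume.restrict U) ∧ ∀ v : E, ∃ w : E → F, HasWeakDeriv U u v w

open Classical in
/-- The weak derivative `∂_v u` on `U` (a representative of it; it is unique up to null sets),
and `0` if there is none. -/
def weakDeriv (U : Set E) (u : E → F) (v : E) : E → F :=
  if h : ∃ w : E → F, HasWeakDeriv U u v w then h.choose else 0

/-- The space `H¹(U; 𝕊)` of the `H¹(U; F)`-functions with `|m| = 1` almost everywhere in `U`. -/
def MemH1Sphere (U : Set E) (m : E → F) : Prop :=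
  MemH1 U m ∧ ∀ᵐ x ∂(volume.restrict U), ‖m x‖ = 1

end Sobolev

/-- The open set `U ⊆ ℝ²` has Lipschitz boundary: near each boundary point, in suitable Cartesian
coordinates centred there, `U` is the strict epigraph of a Lipschitz function. -/
def HasLipschitzBoundary (U : Set Plane) : Prop :=
  ∀ p ∈ frontier U, ∃ (T : Plane ≃ᵃⁱ[ℝ] Plane) (r h : ℝ) (K : ℝ≥0) (γ : ℝ → ℝ),
    T p = 0 ∧ 0 < r ∧ 0 < h ∧ LipschitzWith K γ ∧
      ∀ y : Plane, |T y 0| < r → |T y 1| < h → (y ∈ U ↔ γ (T y 0) < T y 1)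

/-- `Q`-periodicity of a function on the plane. -/
def IsPeriodic (f : Plane → ℝ) : Prop :=
  ∀ (j : Fin 2) (x : Plane), f (x + EuclideanSpace.single j 1) = f x

/-- The open unit square `Q = (0,1)²`. -/
def unitSquare : Set Plane := {x | ∀ j : Fin 2, 0 < x j ∧ x j < 1}

/-- The region `{(x', x₃) : x' ∈ B, g₁(x') < x₃ < g₂(x')}` between two graphs. -/
def between (B : Set Plane) (g₁ g₂ : Plane → ℝ) : Set Space :=
  {x | x.1 ∈ B ∧ g₁ x.1 < x.2 ∧ x.2 < g₂ x.1}

/-- The rescaled film `Ω_ε = {(x', x₃) : x' ∈ ω, f₁(x'/ε) < x₃ < f₂(x'/ε)}`. -/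
def film (ω : Set Plane) (f₁ f₂ : Plane → ℝ) (ε : ℝ) : Set Space :=
  between ω (fun x => f₁ (ε⁻¹ • x)) (fun x => f₂ (ε⁻¹ • x))

/-- The cell `Q_{f₁,f₂} = {(y', y₃) : y' ∈ Q, f₁(y') < y₃ < f₂(y')}`. -/
def cell (f₁ f₂ : Plane → ℝ) : Set Space := between unitSquare f₁ f₂

/-- The `3 × 2` weak gradient `∇m` of a map `m : ω → ℝ³`, `ω ⊆ ℝ²`. -/
def grad₂ (ω : Set Plane) (m : Plane → Vec3) (x : Plane) : Matrix (Fin 3) (Fin 2) ℝ :=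
  Matrix.of fun i j => weakDeriv ω m (EuclideanSpace.single j 1) x i

/-- The `3 × 2` in-plane weak gradient `∇_{x'} m` of a map `m : U → ℝ³`, `U ⊆ ℝ³`. -/
def gradPlane (U : Set Space) (m : Space → Vec3) (x : Space) : Matrix (Fin 3) (Fin 2) ℝ :=
  Matrix.of fun i j => weakDeriv U m (EuclideanSpace.single j 1, 0) x i

/-- The vertical weak derivative `∂₃ m` of a map `m : U → ℝ³`, `U ⊆ ℝ³`. -/
def derivVert (U : Set Space) (m : Space → Vec3) (x : Space) : Vec3 :=
  weakDeriv U m (0, 1) x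

/-- The squared Euclidean (Frobenius) norm `|A|² = ∑ A_{ij}²`. -/
def frobSq (A : Matrix (Fin 3) (Fin 2) ℝ) : ℝ := ∑ i, ∑ j, A i j ^ 2

/-- The space `H¹_#(Q_{f₁,f₂}; ℝ³)` of `H¹`-functions on the cell that are `Q`-periodic in `y'`
(opposite lateral traces agree), each represented by its periodic extension: the extension is
`Q`-periodic in `y'` and is `H¹` on every bounded portion of the strip `f₁(y') < y₃ < f₂(y')`, so
in particular on the cell and across its lateral faces. -/
def MemH1Per (f₁ f₂ : Plane → ℝ) (φ : Space → Vec3) : Prop :=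
  (∀ (j : Fin 2) (y : Space), φ (y + (EuclideanSpace.single j 1, 0)) = φ y) ∧
    ∀ B : Set Plane, IsOpen B → Bornology.IsBounded B → MemH1 (between B f₁ f₂) φ

/-- The homogenized exchange energy density
`g_hom(ξ) = inf_{φ ∈ H¹_#} ∫_{Q_{f₁,f₂}} (|ξ + ∇_{y'} φ|² + |∂_{y₃} φ|²) dy`. -/
def gHom (f₁ f₂ : Plane → ℝ) (ξ : Matrix (Fin 3) (Fin 2) ℝ) : ℝ :=
  ⨅ φ : {φ : Space → Vec3 // MemH1Per f₁ f₂ φ},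
    ∫ y in cell f₁ f₂, (frobSq (ξ + gradPlane (cell f₁ f₂) φ.1 y)
      + ‖derivVert (cell f₁ f₂) φ.1 y‖ ^ 2)

/-- The rescaled exchange energy `∫_{Ω_ε} (|∇_{x'} m|² + ε⁻² |∂₃ m|²) dx ∈ [0, ∞]`. -/
def exchangeEnergy (ω : Set Plane) (f₁ f₂ : Plane → ℝ) (ε : ℝ) (m : Space → Vec3) : ℝ≥0∞ :=
  ∫⁻ x in film ω f₁ f₂ ε, ENNReal.ofReal
    (frobSq (gradPlane (film ω f₁ f₂ ε) m x) + 1 / ε ^ 2 * ‖derivVert (film ω f₁ f₂ ε) m x‖ ^ 2)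

end ThinFilm

end

open ThinFilm

open ThinFilm

set_option linter.unusedSectionVars false

noncomputable section

namespace ThinFilm

section QuadraticForm

variable {H : Type*} [NormedAddCommGroup H] [InnerProductSpace ℝ H] {P : Type*} [Fintype P]

theorem norm_sq_sum_smul (ζ : P → ℝ) (a : P → H) :
    ‖∑ p, ζ p • a p‖ ^ 2 = ∑ p, ∑ q, (ζ p * ζ q) * inner ℝ (a p) (a q) := by
  rw [← real_inner_self_eq_norm_sq]
  simp only [inner_sum, sum_inner, real_inner_smul_left, real_inner_smul_right]
  rw [Finset.sum_comm]
  refine Finset.sum_congr rfl fun p _ => Finset.sum_congr rfl fun q _ => ?_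
  ring

theorem norm_sq_sum_smul_le (ζ : P → ℝ) (a : P → H) :
    ‖∑ p, ζ p • a p‖ ^ 2 ≤ (∑ p, ‖a p‖ ^ 2) * ∑ p, ζ p ^ 2 := by
  have h1 : ‖∑ p, ζ p • a p‖ ≤ ∑ p, ‖a p‖ * |ζ p| :=
    (norm_sum_le _ _).trans_eq (Finset.sum_congr rfl fun p _ => by
      rw [norm_smul, Real.norm_eq_abs, mul_comm])
  refine (pow_le_pow_left₀ (norm_nonneg _) h1 2).trans ?_
  simpa using Finset.sum_mul_sq_le_sq_mul_sq Finset.univ (fun p => ‖a p‖) fun p => |ζ p|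

theorem norm_sq_sub_norm_sq_sum_sub (ζ ψ : P → ℝ) (a : P → H) :
    ‖∑ p, ζ p • a p‖ ^ 2 - ‖∑ p, (ζ p - ψ p) • a p‖ ^ 2
      = 2 * (∑ p, ψ p * inner ℝ (∑ q, ζ q • a q) (a p))
        - ∑ p, ∑ q, (ψ p * ψ q) * inner ℝ (a p) (a q) := by
  rw [← norm_sq_sum_smul]
  simp only [sub_smul, Finset.sum_sub_distrib]
  rw [norm_sub_sq_real, inner_sum (f := fun p => ψ p • a p)]
  simp only [real_inner_smul_right]
  ring

end QuadraticForm

section WeakDerivCalculus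

variable {E F : Type*} [NormedAddCommGroup E] [NormedSpace ℝ E] [MeasureSpace E]
  [NormedAddCommGroup F] [NormedSpace ℝ F]

/-- A product of an `L²` weight with an `L²` function is integrable. -/
theorem integrable_smul_of_memLp_two {α : Type*} {mα : MeasurableSpace α} {μ : Measure α}
    {a : α → ℝ} {u : α → F} (ha : MemLp a 2 μ) (hu : MemLp u 2 μ) :
    Integrable (fun x => a x • u x) μ :=
  memLp_one_iff_integrable.1 (hu.smul ha)

theorem continuous_fderiv_apply {φ : E → ℝ} (hφ : ContDiff ℝ (⊤ : ℕ∞) φ) (v : E) :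
    Continuous fun x => fderiv ℝ φ x v :=
  (hφ.continuous_fderiv (by simp)).clm_apply continuous_const

theorem hasCompactSupport_fderiv_apply' {φ : E → ℝ} (hφ : HasCompactSupport φ) (v : E) :
    HasCompactSupport fun x => fderiv ℝ φ x v :=
  (hφ.fderiv (𝕜 := ℝ)).comp_left (g := fun L : E →L[ℝ] ℝ => L v) (by simp)

theorem HasWeakDeriv.mono {U V : Set E} {u : E → F} {v : E} {w : E → F}
    (h : HasWeakDeriv U u v w) (hVU : V ⊆ U) (hU : MeasurableSet U) :
    HasWeakDeriv V u v w := by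
  refine ⟨h.1.mono_measure (Measure.restrict_mono hVU le_rfl),
    h.2.1.mono_measure (Measure.restrict_mono hVU le_rfl), fun φ hφ hc hs => ?_⟩
  have key := h.2.2 φ hφ hc (hs.trans hVU)
  rw [setIntegral_eq_of_subset_of_forall_sdiff_eq_zero hU hVU,
    setIntegral_eq_of_subset_of_forall_sdiff_eq_zero hU hVU] at key
  · exact key
  · intro x hx
    have : φ x = 0 := by
      by_contra h0
      exact hx.2 (hs (subset_tsupport _ h0))
    simp [this]
  · intro x hx
    have : fderiv ℝ φ x = 0 := by
      by_contra h0
      exact hx.2 (hs (support_fderiv_subset ℝ h0))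
    simp [this]

theorem MemH1.hasWeakDeriv {U : Set E} {u : E → F} (h : MemH1 U u) (v : E) :
    HasWeakDeriv U u v (weakDeriv U u v) := by
  have := h.2 v
  rw [weakDeriv, dif_pos this]
  exact this.choose_spec

theorem HasWeakDeriv.congr_ae {U : Set E} {u u' : E → F} {v : E} {w w' : E → F}
    (h : HasWeakDeriv U u v w) (hu : u =ᵐ[volume.restrict U] u')
    (hw : w =ᵐ[volume.restrict U] w') : HasWeakDeriv U u' v w' := by
  refine ⟨h.1.ae_eq hu, h.2.1.ae_eq hw, fun φ hφ hc hs => ?_⟩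
  rw [← integral_congr_ae (hu.mono fun x hx => congrArg (fderiv ℝ φ x v • ·) hx),
    ← integral_congr_ae (hw.mono fun x hx => congrArg (φ x • ·) hx)]
  exact h.2.2 φ hφ hc hs

theorem hasWeakDeriv_zero (U : Set E) (v : E) : HasWeakDeriv U (0 : E → F) v 0 :=
  ⟨MemLp.zero, MemLp.zero, fun φ _ _ _ => by simp⟩

theorem HasWeakDeriv.const_smul {U : Set E} {u : E → F} {v : E} {w : E → F}
    (h : HasWeakDeriv U u v w) (c : ℝ) : HasWeakDeriv U (c • u) v (c • w) := by
  refine ⟨h.1.const_smul c, h.2.1.const_smul c, fun φ hφ hc hs => ?_⟩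
  simp only [Pi.smul_apply, smul_comm _ c, integral_smul]
  rw [h.2.2 φ hφ hc hs, smul_neg]

theorem HasWeakDeriv.smul_dir {U : Set E} {u : E → F} {v : E} {w : E → F}
    (h : HasWeakDeriv U u v w) (c : ℝ) : HasWeakDeriv U u (c • v) (c • w) := by
  refine ⟨h.1, h.2.1.const_smul c, fun φ hφ hc hs => ?_⟩
  simp only [map_smul, Pi.smul_apply, smul_comm _ c, smul_assoc, integral_smul]
  rw [h.2.2 φ hφ hc hs, smul_neg]

variable [BorelSpace E] [FiniteDimensional ℝ E] [(volume : Measure E).IsAddHaarMeasure]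

theorem integrable_test_smul {U : Set E} {φ : E → ℝ} (hφ : Continuous φ)
    (hc : HasCompactSupport φ) {u : E → F} (hu : MemLp u 2 (volume.restrict U)) :
    Integrable (fun x => φ x • u x) (volume.restrict U) :=
  integrable_smul_of_memLp_two ((hφ.memLp_of_hasCompactSupport hc).restrict _) hu

theorem integrable_fderiv_smul {U : Set E} {φ : E → ℝ} (hφ : ContDiff ℝ (⊤ : ℕ∞) φ)
    (hc : HasCompactSupport φ) (v : E) {u : E → F} (hu : MemLp u 2 (volume.restrict U)) :
    Integrable (fun x => fderiv ℝ φ x v • u x) (volume.restrict U) :=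
  integrable_test_smul (continuous_fderiv_apply hφ v) (hasCompactSupport_fderiv_apply' hc v) hu

theorem HasWeakDeriv.add {U : Set E} {u u' : E → F} {v : E} {w w' : E → F}
    (h : HasWeakDeriv U u v w) (h' : HasWeakDeriv U u' v w') :
    HasWeakDeriv U (u + u') v (w + w') := by
  refine ⟨h.1.add h'.1, h.2.1.add h'.2.1, fun φ hφ hc hs => ?_⟩
  simp only [Pi.add_apply, smul_add]
  rw [integral_add (integrable_fderiv_smul hφ hc v h.1) (integrable_fderiv_smul hφ hc v h'.1),
    integral_add (integrable_test_smul hφ.continuous hc h.2.1)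
      (integrable_test_smul hφ.continuous hc h'.2.1), h.2.2 φ hφ hc hs, h'.2.2 φ hφ hc hs, neg_add]

theorem HasWeakDeriv.add_dir {U : Set E} {u : E → F} {v v' : E} {w w' : E → F}
    (h : HasWeakDeriv U u v w) (h' : HasWeakDeriv U u v' w') :
    HasWeakDeriv U u (v + v') (w + w') := by
  refine ⟨h.1, h.2.1.add h'.2.1, fun φ hφ hc hs => ?_⟩
  simp only [map_add, Pi.add_apply, smul_add, add_smul]
  rw [integral_add (integrable_fderiv_smul hφ hc v h.1) (integrable_fderiv_smul hφ hc v' h.1),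
    integral_add (integrable_test_smul hφ.continuous hc h.2.1)
      (integrable_test_smul hφ.continuous hc h'.2.1), h.2.2 φ hφ hc hs, h'.2.2 φ hφ hc hs, neg_add]

theorem hasWeakDeriv_sum {ι : Type*} (s : Finset ι) {U : Set E} {u w : ι → E → F} {v : E}
    (h : ∀ i ∈ s, HasWeakDeriv U (u i) v (w i)) :
    HasWeakDeriv U (∑ i ∈ s, u i) v (∑ i ∈ s, w i) := by
  classical
  induction s using Finset.induction_on with
  | empty => simpa using hasWeakDeriv_zero U v
  | insert i s hi ih =>
    rw [Finset.sum_insert hi, Finset.sum_insert hi]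
    exact (h i (by simp)).add (ih fun j hj => h j (by simp [hj]))

theorem hasWeakDeriv_sum_dir {ι : Type*} (s : Finset ι) {U : Set E} {u : E → F} {w : ι → E → F}
    {v : ι → E} (hu : MemLp u 2 (volume.restrict U)) (h : ∀ i ∈ s, HasWeakDeriv U u (v i) (w i)) :
    HasWeakDeriv U u (∑ i ∈ s, v i) (∑ i ∈ s, w i) := by
  classical
  induction s using Finset.induction_on with
  | empty => exact ⟨hu, by simp, fun φ _ _ _ => by simp⟩
  | insert i s hi ih =>
    rw [Finset.sum_insert hi, Finset.sum_insert hi]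
    exact (h i (by simp)).add_dir (ih fun j hj => h j (by simp [hj]))

theorem HasWeakDeriv.ae_unique [CompleteSpace F] {U : Set E} (hU : IsOpen U) {u : E → F} {v : E}
    {w w' : E → F} (h : HasWeakDeriv U u v w) (h' : HasWeakDeriv U u v w') :
    w =ᵐ[volume.restrict U] w' := by
  have hd : MemLp (w - w') 2 (volume.restrict U) := h.2.1.sub h'.2.1
  have hloc : LocallyIntegrableOn (w - w') U volume :=
    locallyIntegrableOn_of_locallyIntegrable_restrict (hd.locallyIntegrable one_le_two)
  have := hU.ae_eq_zero_of_integral_contDiff_smul_eq_zero hloc fun φ hφ hc hs => by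
    rw [← setIntegral_eq_integral_of_forall_compl_eq_zero (s := U)]
    · simp only [Pi.sub_apply, smul_sub]
      rw [integral_sub (integrable_test_smul hφ.continuous hc h.2.1)
        (integrable_test_smul hφ.continuous hc h'.2.1), sub_eq_zero]
      exact neg_injective ((h.2.2 φ hφ hc hs).symm.trans (h'.2.2 φ hφ hc hs))
    · intro x hx
      have : φ x = 0 := by
        by_contra h0
        exact hx (hs (subset_tsupport _ h0))
      simp [this]
  rw [EventuallyEq, ae_restrict_iff' hU.measurableSet]
  filter_upwards [this] with x hx hxU
  exact sub_eq_zero.1 (hx hxU)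

/-- Weak derivatives under an affine change of variables `T y = L y + a`. -/
theorem HasWeakDeriv.comp_affine {U : Set E} {u : E → F} {v : E} {w : E → F} (L : E ≃L[ℝ] E)
    (a : E) {c : ℝ≥0∞} (hc : c ≠ ∞)
    (hvol : Measure.map (fun y => L y + a) (volume : Measure E) = c • volume)
    (h : HasWeakDeriv U u (L v) w) :
    HasWeakDeriv ((fun y => L y + a) ⁻¹' U) (fun y => u (L y + a)) v (fun y => w (L y + a)) := by
  set T : E ≃ₜ E := L.toHomeomorph.trans (Homeomorph.addRight a) with hT
  have hTe : ∀ y, T y = L y + a := fun y => rfl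
  have hTm : MeasurableEmbedding fun y => L y + a := T.measurableEmbedding
  have hres : Measure.map (fun y => L y + a) (volume.restrict ((fun y => L y + a) ⁻¹' U))
      = c • volume.restrict U := by
    rw [← hTm.restrict_map, hvol, Measure.restrict_smul]
  have hmem : ∀ {g : E → F}, MemLp g 2 (volume.restrict U) →
      MemLp (fun y => g (L y + a)) 2 (volume.restrict ((fun y => L y + a) ⁻¹' U)) := by
    intro g hg
    have := hg.smul_measure hc
    rw [← hres, hTm.memLp_map_measure_iff] at this
    exact this
  have hint : ∀ g : E → F, ∫ y in (fun y => L y + a) ⁻¹' U, g (L y + a)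
      = c.toReal • ∫ x in U, g x := by
    intro g
    rw [← hTm.setIntegral_map, hvol, Measure.restrict_smul, integral_smul_measure]
  refine ⟨hmem h.1, hmem h.2.1, fun φ hφ hcs hs => ?_⟩
  have hTs : ∀ x, T.symm x = L.symm (x - a) := fun x => by
    apply T.injective
    rw [T.apply_symm_apply, hTe]
    simp
  set ψ : E → ℝ := fun x => φ (T.symm x) with hψ
  have hψc : ContDiff ℝ (⊤ : ℕ∞) ψ := by
    simp only [hψ, hTs]
    exact hφ.comp (L.symm.contDiff.comp (contDiff_id.sub contDiff_const))
  have hψs : HasCompactSupport ψ := hcs.comp_homeomorph T.symm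
  have hψt : tsupport ψ ⊆ U := by
    have : tsupport ψ = T.symm ⁻¹' tsupport φ := tsupport_comp_eq_preimage φ T.symm
    rw [this]
    intro x hx
    have := hs hx
    rwa [Set.mem_preimage, ← hTe, T.apply_symm_apply] at this
  have hfd : ∀ y, fderiv ℝ ψ (L y + a) (L v) = fderiv ℝ φ y v := by
    intro y
    have h1 : HasFDerivAt (fun x => L.symm (x - a)) (L.symm : E →L[ℝ] E) (L y + a) :=
      L.symm.hasFDerivAt.comp (L y + a) ((hasFDerivAt_id _).sub_const a)
    have h2 : HasFDerivAt φ (fderiv ℝ φ y) (L.symm (L y + a - a)) := by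
      simpa using (hφ.differentiable (by simp) y).hasFDerivAt
    have h3 : ψ = φ ∘ fun x => L.symm (x - a) := by
      ext x
      simp [hψ, hTs]
    rw [h3, (h2.comp (L y + a) h1).fderiv]
    simp
  have hφψ : ∀ y, φ y = ψ (L y + a) := fun y => by
    simp [hψ, ← hTe]
  have key := h.2.2 ψ hψc hψs hψt
  have e1 := hint fun x => fderiv ℝ ψ x (L v) • u x
  have e2 := hint fun x => ψ x • w x
  simp only [hfd] at e1
  simp only [← hφψ] at e2
  rw [e1, e2, key, smul_neg]

theorem HasWeakDeriv.comp_add {U : Set E} {u : E → F} {v : E} {w : E → F} (a : E)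
    (h : HasWeakDeriv U u v w) :
    HasWeakDeriv ((fun y => y + a) ⁻¹' U) (fun y => u (y + a)) v (fun y => w (y + a)) := by
  refine HasWeakDeriv.comp_affine (ContinuousLinearEquiv.refl ℝ E) a ENNReal.one_ne_top
    ?_ h
  simpa using map_add_right_eq_self volume a

end WeakDerivCalculus

section Lattice

instance isAddHaarMeasure_volume_space : (volume : Measure Space).IsAddHaarMeasure :=
  inferInstanceAs ((volume : Measure Plane).prod (volume : Measure ℝ)).IsAddHaarMeasure

/-- The horizontal integer lattice `ℤ² × {0}`. -/
def lattice : AddSubgroup Space where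
  carrier := {y | (∀ j, ∃ k : ℤ, y.1 j = k) ∧ y.2 = 0}
  add_mem' := by
    rintro a b ⟨ha, ha'⟩ ⟨hb, hb'⟩
    refine ⟨fun j => ?_, by simp [ha', hb']⟩
    obtain ⟨k, hk⟩ := ha j
    obtain ⟨l, hl⟩ := hb j
    exact ⟨k + l, by simp [hk, hl]⟩
  zero_mem' := ⟨fun j => ⟨0, by simp⟩, rfl⟩
  neg_mem' := by
    rintro a ⟨ha, ha'⟩
    refine ⟨fun j => ?_, by simp [ha']⟩
    obtain ⟨k, hk⟩ := ha j
    exact ⟨-k, by simp [hk]⟩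

/-- The lattice point with given integer coordinates. -/
def latticePoint (k : Fin 2 → ℤ) : Space := (WithLp.toLp 2 fun j => (k j : ℝ), 0)

theorem latticePoint_mem (k : Fin 2 → ℤ) : latticePoint k ∈ lattice :=
  ⟨fun j => ⟨k j, rfl⟩, rfl⟩

theorem exists_latticePoint_eq {g : Space} (hg : g ∈ lattice) : ∃ k, latticePoint k = g := by
  obtain ⟨h1, h2⟩ := hg
  choose k hk using h1
  refine ⟨k, Prod.ext ?_ h2.symm⟩
  ext j
  exact (hk j).symm

instance countable_lattice : Countable lattice := by
  have : Function.Surjective fun k => (⟨latticePoint k, latticePoint_mem k⟩ : lattice) := by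
    rintro ⟨g, hg⟩
    obtain ⟨k, hk⟩ := exists_latticePoint_eq hg
    exact ⟨k, Subtype.ext hk⟩
  exact this.countable

theorem finite_lattice_norm_le (R : ℝ) : {g : lattice | ‖(g : Space).1‖ ≤ R}.Finite := by
  have hfin : (Set.Icc (fun _ : Fin 2 => -⌈R⌉) (fun _ => ⌈R⌉)).Finite := Set.finite_Icc _ _
  refine (hfin.image fun k => (⟨latticePoint k, latticePoint_mem k⟩ : lattice)).subset ?_
  rintro ⟨g, hg⟩ hgR
  obtain ⟨k, rfl⟩ := exists_latticePoint_eq hg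
  refine ⟨k, ?_, rfl⟩
  have h : ∀ j, |(k j : ℝ)| ≤ R := fun j => by
    have := (PiLp.norm_apply_le (latticePoint k).1 j).trans hgR
    simpa [latticePoint] using this
  constructor <;> intro j
  · have h1 := (abs_le.1 (h j)).1
    have h2 := Int.le_ceil R
    have : (-⌈R⌉ : ℝ) ≤ k j := by linarith
    exact_mod_cast this
  · have h1 := (abs_le.1 (h j)).2
    have h2 := Int.le_ceil R
    have : (k j : ℝ) ≤ ⌈R⌉ := by linarith
    exact_mod_cast this

/-- The half-open vertical column over the unit square. -/
def column : Set Space := {y | ∀ j, 0 ≤ y.1 j ∧ y.1 j < 1}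

theorem measurable_coord (j : Fin 2) : Measurable fun y : Space => y.1 j := by
  fun_prop

theorem measurableSet_column : MeasurableSet column := by
  have : column = ⋂ j, (fun y : Space => y.1 j) ⁻¹' Set.Ico 0 1 := by
    ext y
    simp [column]
  rw [this]
  exact MeasurableSet.iInter fun j => measurable_coord j measurableSet_Ico

/-- The coordinatewise fractional part of the horizontal variable. -/
def fractPart (y : Space) : Space := (WithLp.toLp 2 fun j => Int.fract (y.1 j), y.2)

theorem fractPart_mem (y : Space) : fractPart y ∈ column :=
  fun j => ⟨Int.fract_nonneg (y.1 j), Int.fract_lt_one (y.1 j)⟩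

theorem fractPart_sub_mem (y : Space) : fractPart y - y ∈ lattice := by
  refine ⟨fun j => ⟨-⌊y.1 j⌋, ?_⟩, by simp [fractPart]⟩
  change Int.fract (y.1 j) - y.1 j = _
  rw [Int.fract]
  push_cast
  ring

theorem fractPart_add {g : Space} (hg : g ∈ lattice) (y : Space) :
    fractPart (g + y) = fractPart y := by
  obtain ⟨k, rfl⟩ := exists_latticePoint_eq hg
  refine Prod.ext ?_ (by simp [fractPart, latticePoint])
  ext j
  simp [fractPart, latticePoint]

theorem fractPart_of_mem {y : Space} (hy : y ∈ column) : fractPart y = y := by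
  refine Prod.ext ?_ rfl
  ext j
  exact Int.fract_eq_self.2 (hy j)

theorem measurable_fractPart : Measurable fractPart := by
  unfold fractPart
  refine Measurable.prodMk ?_ measurable_snd
  refine (WithLp.measurable_toLp 2 _).comp (measurable_pi_lambda _ fun j => ?_)
  exact measurable_fract.comp (measurable_coord j)

theorem isAddFundamentalDomain_column :
    IsAddFundamentalDomain lattice column (volume : Measure Space) := by
  refine .mk' measurableSet_column.nullMeasurableSet fun y => ?_
  refine ⟨⟨fractPart y - y, fractPart_sub_mem y⟩, ?_, ?_⟩
  · change (fractPart y - y) + y ∈ column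
    simpa using fractPart_mem y
  · rintro ⟨g, hg⟩ (h : g + y ∈ column)
    ext1
    have := fractPart_of_mem h
    rw [fractPart_add hg] at this
    simp [this]

/-- Invariance under the horizontal integer lattice. -/
def LatticePeriodic {X : Type*} (h : Space → X) : Prop :=
  ∀ g ∈ lattice, ∀ y, h (g + y) = h y

theorem latticePeriodic_of_unit {X : Type*} {h : Space → X}
    (hh : ∀ (j : Fin 2) (y : Space), h (y + (EuclideanSpace.single j 1, 0)) = h y) :
    LatticePeriodic h := by
  intro g hg y
  obtain ⟨k, rfl⟩ := exists_latticePoint_eq hg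
  have h0 : Function.Periodic h (EuclideanSpace.single (0 : Fin 2) (1 : ℝ), (0 : ℝ)) := hh 0
  have h1 : Function.Periodic h (EuclideanSpace.single (1 : Fin 2) (1 : ℝ), (0 : ℝ)) := hh 1
  have e : latticePoint k + y = y + k 0 • (EuclideanSpace.single (0 : Fin 2) (1 : ℝ), (0 : ℝ))
      + k 1 • (EuclideanSpace.single (1 : Fin 2) (1 : ℝ), (0 : ℝ)) := by
    refine Prod.ext ?_ (by simp [latticePoint])
    ext j
    fin_cases j <;> simp [latticePoint, add_comm]
  rw [e, (h1.zsmul (k 1)) _, (h0.zsmul (k 0)) _]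

theorem LatticePeriodic.comp {X Y : Type*} {h : Space → X} (hh : LatticePeriodic h) (f : X → Y) :
    LatticePeriodic fun y => f (h y) := fun g hg y => congrArg f (hh g hg y)

theorem LatticePeriodic.shift {X : Type*} {h : Space → X} (hh : LatticePeriodic h) (a : Space) :
    LatticePeriodic fun y => h (y + a) := fun g hg y => by
  simp only [add_assoc]
  exact hh g hg _

theorem column_shift (a : Space) :
    IsAddFundamentalDomain lattice ((fun y => y + a) ⁻¹' column) (volume : Measure Space) := by
  have hm : MeasurableSet ((fun y : Space => y + a) ⁻¹' column) :=
    measurableSet_column.preimage (measurable_add_const a)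
  refine .mk' hm.nullMeasurableSet fun y => ?_
  refine ⟨⟨fractPart (y + a) - (y + a), fractPart_sub_mem _⟩, ?_, ?_⟩
  · change (fractPart (y + a) - (y + a)) + y + a ∈ column
    rw [add_assoc, sub_add_cancel]
    exact fractPart_mem _
  · rintro ⟨g, hg⟩ (h : g + y + a ∈ column)
    ext1
    rw [add_assoc] at h
    have := fractPart_of_mem h
    rw [fractPart_add hg] at this
    simp [this]

theorem lintegral_column_shift {h : Space → ℝ≥0∞} (hh : LatticePeriodic h) (a : Space) :
    ∫⁻ y in column, h (y + a) = ∫⁻ y in column, h y := by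
  rw [isAddFundamentalDomain_column.setLIntegral_eq (column_shift a) _
    (fun g y => (hh.shift a) g g.2 y)]
  exact (measurePreserving_add_right volume a).setLIntegral_comp_preimage_emb
    (measurableEmbedding_addRight a) h column

theorem integral_column_shift {h : Space → ℝ} (hh : LatticePeriodic h) (a : Space) :
    ∫ y in column, h (y + a) = ∫ y in column, h y := by
  rw [isAddFundamentalDomain_column.setIntegral_eq (column_shift a)
    (fun g y => (hh.shift a) g g.2 y)]
  exact (measurePreserving_add_right volume a).setIntegral_preimage_emb
    (measurableEmbedding_addRight a) h column

/-- The half-open unit square. -/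
def base : Set Plane := {z | ∀ j, 0 ≤ z j ∧ z j < 1}

theorem base_eq_preimage : base = (MeasurableEquiv.toLp 2 (Fin 2 → ℝ)).symm ⁻¹'
    (Set.univ.pi fun _ => Set.Ico (0 : ℝ) 1) := by
  ext z
  simp [base]

theorem measurableSet_base : MeasurableSet base := by
  rw [base_eq_preimage]
  exact (MeasurableEquiv.measurable _) (MeasurableSet.univ_pi fun _ => measurableSet_Ico)

theorem volume_base : volume base = 1 := by
  rw [base_eq_preimage, (EuclideanSpace.volume_preserving_symm_measurableEquiv_toLp
    (Fin 2)).measure_preimage_equiv, Real.volume_pi_Ico]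
  simp

instance isProbabilityMeasure_base : IsProbabilityMeasure (volume.restrict base) :=
  ⟨by simp [volume_base]⟩

theorem column_eq_prod : column = base ×ˢ (Set.univ : Set ℝ) := by
  ext y
  simp [column, base]

theorem restrict_column :
    (volume : Measure Space).restrict column = (volume.restrict base).prod volume := by
  rw [column_eq_prod, Measure.volume_eq_prod, ← Measure.prod_restrict, Measure.restrict_univ]

theorem norm_le_of_mem_base {z : Plane} (hz : z ∈ base) : ‖z‖ ≤ 2 := by
  rw [EuclideanSpace.norm_eq, Real.sqrt_le_left (by norm_num), Fin.sum_univ_two]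
  have h0 := hz 0
  have h1 := hz 1
  simp only [Real.norm_eq_abs, sq_abs]
  nlinarith [h0.1, h0.2, h1.1, h1.2]

/-- Averaging a lattice-periodic function over horizontal translations. -/
theorem lintegral_average {k : Plane → ℝ≥0∞} (hk : Measurable k) {h : Space → ℝ≥0∞}
    (hm : Measurable h) (hh : LatticePeriodic h) :
    ∫⁻ z in base, ∫⁻ y : Space, k y.1 * h (y + (z, 0)) = (∫⁻ x, k x) * ∫⁻ y in column, h y := by
  rw [lintegral_lintegral_swap (by fun_prop)]
  have hin : ∀ y : Space, ∫⁻ z in base, k y.1 * h (y + (z, 0))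
      = k y.1 * ∫⁻ z in base, h (y + (z, 0)) := fun y => lintegral_const_mul _ (by fun_prop)
  simp only [hin]
  rw [Measure.volume_eq_prod, lintegral_prod _ (by fun_prop)]
  have : ∀ x : Plane, ∫⁻ t : ℝ, k x * ∫⁻ z in base, h ((x, t) + (z, 0))
      = k x * ∫⁻ y in column, h y := by
    intro x
    rw [lintegral_const_mul _ (by fun_prop), ← lintegral_column_shift hh (x, 0), restrict_column,
      lintegral_prod _ (by fun_prop), lintegral_lintegral_swap (by fun_prop)]
    simp [add_comm]
  simp only [this]
  rw [lintegral_mul_const _ hk]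
  rfl

theorem integrable_average {k : Plane → ℝ} (hk : Measurable k) (hki : Integrable k)
    {h : Space → ℝ} (hm : Measurable h) (hh : LatticePeriodic h) (hi : IntegrableOn h column) :
    Integrable (Function.uncurry fun (z : Plane) (y : Space) => k y.1 * h (y + (z, 0)))
      ((volume.restrict base).prod volume) := by
  refine ⟨(by fun_prop : Measurable _).aestronglyMeasurable, ?_⟩
  rw [hasFiniteIntegral_iff_enorm, lintegral_prod _ (by fun_prop)]
  simp only [Function.uncurry, enorm_mul]
  rw [lintegral_average (k := fun x => ‖k x‖ₑ) (h := fun y => ‖h y‖ₑ) (by fun_prop)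
    (by fun_prop) (hh.comp _)]
  exact ENNReal.mul_lt_top hki.2 hi.2

theorem integral_average {k : Plane → ℝ} (hk : Measurable k) (hki : Integrable k) {h : Space → ℝ}
    (hm : Measurable h) (hh : LatticePeriodic h) (hi : IntegrableOn h column) :
    ∫ z in base, ∫ y : Space, k y.1 * h (y + (z, 0)) = (∫ x, k x) * ∫ y in column, h y := by
  have hint := integrable_average hk hki hm hh hi
  rw [integral_integral_swap hint]
  simp only [integral_const_mul]
  have hint2 := hint.swap.integral_prod_left
  simp only [Function.comp_def, Prod.swap, Function.uncurry, integral_const_mul] at hint2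
  rw [Measure.volume_eq_prod] at hint2 ⊢
  rw [integral_prod _ hint2]
  have : ∀ x : Plane, ∫ t : ℝ, k x * ∫ z in base, h ((x, t) + (z, 0))
      = k x * ∫ y in column, h y := by
    intro x
    have hix : IntegrableOn (fun y => h (y + (x, 0))) column := by
      refine ⟨(by fun_prop : Measurable _).aestronglyMeasurable, ?_⟩
      rw [hasFiniteIntegral_iff_enorm, lintegral_column_shift (h := fun y => ‖h y‖ₑ) (hh.comp _)]
      exact hi.2
    rw [integral_const_mul, ← integral_column_shift hh (x, 0)]
    rw [IntegrableOn, restrict_column] at hix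
    rw [restrict_column, integral_prod _ hix,
      integral_integral_swap (f := fun z t => h ((z, t) + (x, 0))) hix]
    simp [add_comm]
  simp only [this]
  rw [integral_mul_const]
  rfl

/-- Bounded horizontal pieces of a periodic function, uniformly in the scale. -/
theorem lintegral_ball_le {h : Space → ℝ≥0∞} (hm : Measurable h) (hh : LatticePeriodic h)
    {R r : ℝ} (hR : R + 2 ≤ r) :
    ∫⁻ y in {y : Space | ‖y.1‖ ≤ R}, h y
      ≤ volume (Metric.closedBall (0 : Plane) r) * ∫⁻ y in column, h y := by
  have hms : MeasurableSet {y : Space | ‖y.1‖ ≤ R} :=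
    measurableSet_le (by fun_prop) measurable_const
  set k : Plane → ℝ≥0∞ := (Metric.closedBall (0 : Plane) r).indicator 1
  have hk : Measurable k := measurable_one.indicator Metric.isClosed_closedBall.measurableSet
  have hk1 : ∫⁻ x, k x = volume (Metric.closedBall (0 : Plane) r) :=
    lintegral_indicator_one Metric.isClosed_closedBall.measurableSet
  rw [← hk1, ← lintegral_average hk hm hh]
  have : ∀ z ∈ base, ∫⁻ y in {y : Space | ‖y.1‖ ≤ R}, h y
      ≤ ∫⁻ y : Space, k y.1 * h (y + (z, 0)) := by
    intro z hz
    rw [← lintegral_sub_right_eq_self (fun y : Space => k y.1 * h (y + (z, 0))) (z, 0),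
      ← lintegral_indicator hms]
    refine lintegral_mono fun y => ?_
    by_cases hy : ‖y.1‖ ≤ R
    · have : (y - (z, 0)).1 ∈ Metric.closedBall (0 : Plane) r := by
        rw [mem_closedBall_zero_iff]
        calc ‖y.1 - z‖ ≤ ‖y.1‖ + ‖z‖ := norm_sub_le _ _
          _ ≤ r := by linarith [norm_le_of_mem_base hz]
      simp only [k]
      rw [Set.indicator_of_mem this,
        Set.indicator_of_mem (show y ∈ {y : Space | ‖y.1‖ ≤ R} from hy)]
      simp
    · simp [Set.indicator_of_notMem (show y ∉ {y : Space | ‖y.1‖ ≤ R} from hy)]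
  calc ∫⁻ y in {y : Space | ‖y.1‖ ≤ R}, h y
      = ∫⁻ z in base, ∫⁻ y in {y : Space | ‖y.1‖ ≤ R}, h y := by simp
    _ ≤ _ := setLIntegral_mono' measurableSet_base this

theorem integrableOn_ball {h : Space → ℝ} (hm : Measurable h) (hh : LatticePeriodic h)
    (hi : IntegrableOn h column) (R : ℝ) : IntegrableOn h {y : Space | ‖y.1‖ ≤ R} := by
  refine ⟨hm.aestronglyMeasurable, ?_⟩
  rw [hasFiniteIntegral_iff_enorm]
  refine (lintegral_ball_le (h := fun y => ‖h y‖ₑ) (by fun_prop) (hh.comp _) le_rfl).trans_lt ?_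
  exact ENNReal.mul_lt_top measure_closedBall_lt_top hi.2

theorem integrable_mul_periodic {F : Plane → ℝ} (hF : Continuous F) (hc : HasCompactSupport F)
    {h : Space → ℝ} (hm : Measurable h) (hh : LatticePeriodic h) (hi : IntegrableOn h column) :
    Integrable fun y : Space => F y.1 * h y := by
  obtain ⟨R, hR⟩ := hc.isCompact.isBounded.exists_norm_le
  obtain ⟨C, hC⟩ := hF.bounded_above_of_compact_support hc
  have h1 : IntegrableOn (fun y : Space => F y.1 * h y) {y : Space | ‖y.1‖ ≤ R} :=
    (integrableOn_ball hm hh hi R).bdd_mul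
      (hF.comp continuous_fst).aestronglyMeasurable (Eventually.of_forall fun y => hC y.1)
  refine (integrableOn_iff_integrable_of_support_subset fun y hy => ?_).1 h1
  refine hR _ (subset_tsupport _ fun h0 => hy ?_)
  simp [h0]

/-- Weak convergence of rapidly oscillating periodic functions to their mean. -/
theorem tendsto_oscillating {F : Plane → ℝ} (hF : Continuous F) (hc : HasCompactSupport F)
    {h : Space → ℝ} (hm : Measurable h) (hh : LatticePeriodic h) (hi : IntegrableOn h column) :
    Tendsto (fun ε : ℝ => ε ^ 2 * ∫ y : Space, F (ε • y.1) * h y) (𝓝[>] 0)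
      (𝓝 ((∫ x, F x) * ∫ y in column, h y)) := by
  obtain ⟨R, hR⟩ := hc.isCompact.isBounded.exists_norm_le
  have hR' : ∀ x, R < ‖x‖ → F x = 0 := fun x hx => by
    by_contra h0
    exact absurd (hR x (subset_tsupport _ h0)) (not_le.2 hx)
  set V : ℝ := (volume (Metric.closedBall (0 : Plane) (R + 4))).toReal with hV
  set M : ℝ := ∫ y in column, ‖h y‖ with hM
  have hM0 : 0 ≤ M := integral_nonneg fun _ => norm_nonneg _
  have hV0 : 0 ≤ V := ENNReal.toReal_nonneg
  have huc := hc.uniformContinuous_of_continuous hF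
  rw [Metric.tendsto_nhds]
  intro τ hτ
  obtain ⟨δ, hδ, hFδ⟩ := Metric.uniformContinuous_iff.1 huc (τ / (V * M + 1)) (by positivity)
  have hev : ∀ᶠ ε : ℝ in 𝓝[>] 0, 0 < ε ∧ ε < 1 ∧ ε < δ / 2 := by
    filter_upwards [self_mem_nhdsWithin, nhdsWithin_le_nhds (Iio_mem_nhds one_pos),
      nhdsWithin_le_nhds (Iio_mem_nhds (half_pos hδ))] with ε h1 h2 h3 using ⟨h1, h2, h3⟩
  filter_upwards [hev] with ε hε
  obtain ⟨hε0, hε1, hεδ⟩ := hε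
  have hFε : Continuous fun x : Plane => F (ε • x) := by fun_prop
  have hFεc : HasCompactSupport fun x : Plane => F (ε • x) :=
    hc.comp_smul hε0.ne'
  have hFεi : Integrable fun x : Plane => F (ε • x) :=
    hFε.integrable_of_hasCompactSupport hFεc
  have havg := integral_average hFε.measurable hFεi hm hh hi
  have hJi := (integrable_average hFε.measurable hFεi hm hh hi).integral_prod_left
  simp only [Function.uncurry] at hJi
  have hscale : ε ^ 2 * ∫ x : Plane, F (ε • x) = ∫ x, F x := by
    rw [Measure.integral_comp_smul]
    simp [abs_of_pos hε0, hε0.ne']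
  have hshift : ∀ z : Plane, ∫ y : Space, F (ε • y.1) * h (y + (z, 0))
      = ∫ y : Space, F (ε • (y.1 - z)) * h y := fun z => by
    rw [← integral_sub_right_eq_self (fun y : Space => F (ε • y.1) * h (y + (z, 0))) (z, 0)]
    simp
  have hinti : Integrable fun y : Space => F (ε • y.1) * h y :=
    integrable_mul_periodic hFε hFεc hm hh hi
  have hintz : ∀ z : Plane, Integrable fun y : Space => F (ε • (y.1 - z)) * h y := fun z =>
    integrable_mul_periodic (F := fun x => F (ε • (x - z))) (by fun_prop)
      (hFεc.comp_homeomorph (Homeomorph.subRight z)) hm hh hi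
  have hball : ∫ y in {y : Space | ‖y.1‖ ≤ (R + 2) / ε}, ‖h y‖ ≤ (ε ^ 2)⁻¹ * (V * M) := by
    have h1 := lintegral_ball_le (h := fun y => ‖h y‖ₑ) (by fun_prop) (hh.comp _)
      (show (R + 2) / ε + 2 ≤ (R + 4) / ε by
        rw [← sub_nonneg]
        have : (R + 4) / ε - ((R + 2) / ε + 2) = 2 * (1 - ε) / ε := by
          field_simp
          ring
        rw [this]
        have : 0 ≤ 1 - ε := by linarith
        positivity)
    have h2 : volume (Metric.closedBall (0 : Plane) ((R + 4) / ε))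
        = ENNReal.ofReal ((ε ^ 2)⁻¹) * volume (Metric.closedBall (0 : Plane) (R + 4)) := by
      have := Measure.addHaar_smul (volume : Measure Plane) ε⁻¹
        (Metric.closedBall (0 : Plane) (R + 4))
      rw [smul_closedBall' (inv_ne_zero hε0.ne')] at this
      simp only [smul_zero, norm_inv, Real.norm_eq_abs, abs_of_pos hε0, finrank_euclideanSpace,
        Fintype.card_fin] at this
      rw [div_eq_inv_mul, this, ← inv_pow, abs_of_nonneg (by positivity)]
    rw [integral_norm_eq_lintegral_enorm hm.aestronglyMeasurable, hM,
      integral_norm_eq_lintegral_enorm hm.aestronglyMeasurable, hV, ← ENNReal.toReal_mul]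
    rw [h2, mul_assoc] at h1
    have h3 := ENNReal.toReal_mono (ENNReal.mul_lt_top ENNReal.ofReal_lt_top
      (ENNReal.mul_lt_top measure_closedBall_lt_top hi.2)).ne h1
    rwa [ENNReal.toReal_mul, ENNReal.toReal_ofReal (by positivity)] at h3
  have hdiff : ∀ z ∈ base, ‖(∫ y : Space, F (ε • y.1) * h y)
      - ∫ y : Space, F (ε • y.1) * h (y + (z, 0))‖ ≤ (τ / (V * M + 1)) * ((ε ^ 2)⁻¹ * (V * M)) := by
    intro z hz
    have hz2 := norm_le_of_mem_base hz
    rw [hshift, ← integral_sub hinti (hintz z)]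
    refine (norm_integral_le_integral_norm _).trans ?_
    have hms : MeasurableSet {y : Space | ‖y.1‖ ≤ (R + 2) / ε} :=
      measurableSet_le (by fun_prop) measurable_const
    calc ∫ y : Space, ‖F (ε • y.1) * h y - F (ε • (y.1 - z)) * h y‖
        ≤ ∫ y in {y : Space | ‖y.1‖ ≤ (R + 2) / ε}, (τ / (V * M + 1)) * ‖h y‖ := by
          rw [← integral_indicator hms]
          refine integral_mono (hinti.sub (hintz z)).norm
            ((integrable_indicator_iff hms).2 ((integrableOn_ball hm hh hi _).norm.const_mul _))
            fun y => ?_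
          by_cases hy : ‖y.1‖ ≤ (R + 2) / ε
          · simp only
            rw [Set.indicator_of_mem (show y ∈ {y : Space | ‖y.1‖ ≤ (R + 2) / ε} from hy),
              ← sub_mul, norm_mul]
            gcongr
            rw [← dist_eq_norm]
            refine (hFδ ?_).le
            rw [dist_eq_norm, ← smul_sub, sub_sub_cancel, norm_smul, Real.norm_eq_abs,
              abs_of_pos hε0]
            nlinarith
          · simp only
            rw [Set.indicator_of_notMem (show y ∉ {y : Space | ‖y.1‖ ≤ (R + 2) / ε} from hy)]
            rw [not_le, div_lt_iff₀ hε0] at hy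
            have e1 : F (ε • y.1) = 0 := hR' _ (by
              rw [norm_smul, Real.norm_eq_abs, abs_of_pos hε0]
              linarith)
            have e2 : F (ε • (y.1 - z)) = 0 := hR' _ (by
              rw [norm_smul, Real.norm_eq_abs, abs_of_pos hε0]
              have := norm_sub_norm_le y.1 z
              nlinarith)
            simp [e1, e2]
      _ ≤ _ := by
          rw [integral_const_mul]
          gcongr
  have hfin : ε ^ 2 * ∫ y : Space, F (ε • y.1) * h y
      = ∫ z in base, ε ^ 2 * ∫ y : Space, F (ε • y.1) * h y := by
    simp
  rw [dist_eq_norm, ← hscale, mul_assoc, ← havg, hfin,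
    ← integral_const_mul (ε ^ 2) fun z : Plane => ∫ y : Space, F (ε • y.1) * h (y + (z, 0)),
    ← integral_sub (integrable_const _) (hJi.const_mul _)]
  refine (norm_setIntegral_le_of_norm_le_const (C := τ / (V * M + 1) * (V * M))
    (by simp [volume_base]) fun z hz => ?_).trans_lt ?_
  · rw [← mul_sub, norm_mul, norm_pow, Real.norm_eq_abs, sq_abs]
    refine (mul_le_mul_of_nonneg_left (hdiff z hz) (by positivity)).trans_eq ?_
    field_simp
  · rw [Measure.real, volume_base, ENNReal.toReal_one, mul_one, div_mul_eq_mul_div,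
      div_lt_iff₀ (by positivity)]
    nlinarith [mul_nonneg hV0 hM0]

end Lattice

section Geometry

/-- The three coordinate directions. -/
def axis : Fin 3 → Space :=
  ![(EuclideanSpace.single 0 1, 0), (EuclideanSpace.single 1 1, 0), (0, 1)]

theorem eq_sum_axis (v : Space) : v = ∑ j : Fin 3, (![v.1 0, v.1 1, v.2] j) • axis j := by
  refine Prod.ext ?_ ?_
  · ext j
    fin_cases j <;> simp [axis, Fin.sum_univ_three]
  · simp [axis, Fin.sum_univ_three]

/-- The functions `w 0, w 1, w 2` are the weak partial derivatives of `u` on `U`. -/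
def HasGrad (U : Set Space) (u : Space → Vec3) (w : Fin 3 → Space → Vec3) : Prop :=
  ∀ j, HasWeakDeriv U u (axis j) (w j)

theorem HasGrad.memH1 {U : Set Space} {u : Space → Vec3} {w : Fin 3 → Space → Vec3}
    (h : HasGrad U u w) : MemH1 U u := by
  refine ⟨(h 0).1, fun v => ?_⟩
  rw [eq_sum_axis v]
  exact ⟨_, hasWeakDeriv_sum_dir _ (h 0).1 fun j _ => (h j).smul_dir _⟩

theorem MemH1.add {U : Set Space} {u v : Space → Vec3} (hu : MemH1 U u) (hv : MemH1 U v) :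
    MemH1 U (u + v) :=
  ⟨hu.1.add hv.1, fun d => ⟨_, (hu.hasWeakDeriv d).add (hv.hasWeakDeriv d)⟩⟩

theorem MemH1.const_smul {U : Set Space} {u : Space → Vec3} (hu : MemH1 U u) (c : ℝ) :
    MemH1 U (c • u) :=
  ⟨hu.1.const_smul c, fun d => ⟨_, (hu.hasWeakDeriv d).const_smul c⟩⟩

variable {f₁ f₂ : Plane → ℝ}

theorem isOpen_between {B : Set Plane} (hB : IsOpen B) (h₁ : Continuous f₁) (h₂ : Continuous f₂) :
    IsOpen (between B f₁ f₂) :=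
  (hB.preimage continuous_fst).inter
    ((isOpen_lt (h₁.comp continuous_fst) continuous_snd).inter
      (isOpen_lt continuous_snd (h₂.comp continuous_fst)))

theorem isOpen_unitSquare : IsOpen unitSquare := by
  have : unitSquare = ⋂ j : Fin 2, {x : Plane | 0 < x j ∧ x j < 1} := by
    ext x
    simp [unitSquare]
  rw [this]
  exact isOpen_iInter_of_finite fun j =>
    (isOpen_lt (f := fun _ : Plane => (0 : ℝ)) (g := fun x => x j) continuous_const
      (by fun_prop)).inter (isOpen_lt (f := fun x : Plane => x j) (g := fun _ => (1 : ℝ))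
      (by fun_prop) continuous_const)

theorem unitSquare_subset_base : unitSquare ⊆ base := fun _ hx j => ⟨(hx j).1.le, (hx j).2⟩

theorem volume_unitSquare : volume unitSquare = 1 := by
  have : unitSquare = (MeasurableEquiv.toLp 2 (Fin 2 → ℝ)).symm ⁻¹'
      (Set.univ.pi fun _ => Set.Ioo (0 : ℝ) 1) := by
    ext z
    simp [unitSquare]
  rw [this, (EuclideanSpace.volume_preserving_symm_measurableEquiv_toLp
    (Fin 2)).measure_preimage_equiv, Real.volume_pi_Ioo]
  simp

theorem unitSquare_ae_eq_base : unitSquare =ᵐ[volume] base :=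
  ae_eq_of_subset_of_measure_ge unitSquare_subset_base (by rw [volume_base, volume_unitSquare])
    isOpen_unitSquare.measurableSet.nullMeasurableSet (by simp [volume_base])

/-- The strip between the two graphs. -/
abbrev strip (f₁ f₂ : Plane → ℝ) : Set Space := between Set.univ f₁ f₂

theorem restrict_cell (h₁ : Continuous f₁) (h₂ : Continuous f₂) :
    (volume : Measure Space).restrict (cell f₁ f₂)
      = (volume.restrict column).restrict (strip f₁ f₂) := by
  have e : cell f₁ f₂ = strip f₁ f₂ ∩ (unitSquare ×ˢ (Set.univ : Set ℝ)) := by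
    ext y
    simp [cell, between, and_comm]
  rw [e, ← Measure.restrict_restrict (isOpen_between isOpen_univ h₁ h₂).measurableSet,
    restrict_column, Measure.volume_eq_prod, ← Measure.prod_restrict, Measure.restrict_univ,
    Measure.restrict_congr_set unitSquare_ae_eq_base]

theorem IsPeriodic.latticePeriodic {f : Plane → ℝ} (h : IsPeriodic f) :
    LatticePeriodic fun y : Space => f y.1 :=
  latticePeriodic_of_unit fun j y => h j y.1

theorem IsPeriodic.exists_bound {f : Plane → ℝ} (h : IsPeriodic f) (hc : Continuous f) :
    ∃ M, ∀ x, f x ≤ M := by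
  obtain ⟨M, hM⟩ := (isCompact_closedBall (0 : Plane) 2).bddAbove_image hc.continuousOn
  refine ⟨M, fun x => ?_⟩
  have e := h.latticePeriodic _ (fractPart_sub_mem (x, 0)) (x, 0)
  simp only [sub_add_cancel] at e
  rw [← e]
  refine hM ⟨_, ?_, rfl⟩
  rw [mem_closedBall_zero_iff]
  exact norm_le_of_mem_base (fractPart_mem (x, 0))

theorem latticePeriodic_mem_strip (h₁ : IsPeriodic f₁) (h₂ : IsPeriodic f₂) :
    LatticePeriodic fun y => y ∈ strip f₁ f₂ := by
  rintro g hg y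
  have e1 := h₁.latticePeriodic g hg y
  have e2 := h₂.latticePeriodic g hg y
  have e3 : (g + y).2 = y.2 := by simp [hg.2]
  simp only [strip, between, Set.mem_ofPred_eq, Set.mem_univ, true_and] at *
  rw [e1, e2, e3]

theorem volume_between_lt_top {B : Set Plane} (hB : Bornology.IsBounded B) (hp : ∀ x, 0 < f₁ x)
    {M : ℝ} (hM : ∀ x, f₂ x ≤ M) : volume (between B f₁ f₂) < ∞ := by
  have hsub : between B f₁ f₂ ⊆ B ×ˢ Set.Icc 0 M := fun y hy =>
    ⟨hy.1, (hp y.1).le.trans hy.2.1.le, hy.2.2.le.trans (hM y.1)⟩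
  refine (measure_mono hsub).trans_lt ?_
  rw [Measure.volume_eq_prod, Measure.prod_prod]
  exact ENNReal.mul_lt_top hB.measure_lt_top (by simp)

theorem isBounded_unitSquare : Bornology.IsBounded unitSquare :=
  (Metric.isBounded_closedBall (x := (0 : Plane)) (r := 2)).subset fun _ hx => by
    rw [mem_closedBall_zero_iff]
    exact norm_le_of_mem_base (unitSquare_subset_base hx)

end Geometry

section OrthogonalPart

variable {H : Type*} [NormedAddCommGroup H] [InnerProductSpace ℝ H] [CompleteSpace H]

/-- The orthogonal projection onto the orthogonal complement of a subspace. -/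
def orthogonalPart (V : Submodule ℝ H) : H →ₗ[ℝ] H := (Vᗮ.starProjection : H →L[ℝ] H)

theorem orthogonalPart_mem (V : Submodule ℝ H) (x : H) : orthogonalPart V x ∈ Vᗮ :=
  Submodule.starProjection_apply_mem _ _

theorem exists_norm_sub_lt (V : Submodule ℝ H) (x : H) {δ : ℝ} (hδ : 0 < δ) :
    ∃ a ∈ V, ‖x - a‖ < ‖orthogonalPart V x‖ + δ := by
  have hmem : x - orthogonalPart V x ∈ V.topologicalClosure := by
    rw [← Submodule.orthogonal_orthogonal_eq_closure]
    exact Submodule.sub_starProjection_mem_orthogonal _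
  obtain ⟨a, ha, had⟩ := Metric.mem_closure_iff.1 hmem δ hδ
  refine ⟨a, ha, ?_⟩
  rw [dist_eq_norm] at had
  calc ‖x - a‖ = ‖orthogonalPart V x + (x - orthogonalPart V x - a)‖ := by congr 1; abel
    _ < _ := (norm_add_le _ _).trans_lt (by linarith)

theorem inner_orthogonalPart (V : Submodule ℝ H) (x y : H) :
    inner ℝ (orthogonalPart V x) (orthogonalPart V y) = inner ℝ x (orthogonalPart V y) := by
  have h := Submodule.sub_starProjection_mem_orthogonal (K := Vᗮ) x
  have h2 := (Submodule.mem_orthogonal' _ _).1 h _ (orthogonalPart_mem V y)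
  rw [inner_sub_left, sub_eq_zero] at h2
  exact h2.symm

end OrthogonalPart

section CellProblem

variable (f₁ f₂ : Plane → ℝ)

/-- Square-integrable triples of fields on the cell. -/
abbrev CellFields : Type :=
  PiLp 2 fun _ : Fin 3 => Lp Vec3 2 ((volume : Measure Space).restrict (cell f₁ f₂))

/-- The gradients of the admissible functions of the cell problem. -/
def gradSpace : Submodule ℝ (CellFields f₁ f₂) where
  carrier := {a | ∃ φ, MemH1Per f₁ f₂ φ ∧ HasGrad (cell f₁ f₂) φ fun j => a j}
  add_mem' := by
    rintro a b ⟨φ, hφ, ha⟩ ⟨ψ, hψ, hb⟩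
    refine ⟨φ + ψ, ⟨fun j y => by simp [hφ.1, hψ.1], fun B hB hB' =>
      (hφ.2 B hB hB').add (hψ.2 B hB hB')⟩, fun j => ?_⟩
    exact ((ha j).add (hb j)).congr_ae .rfl (Lp.coeFn_add _ _).symm
  zero_mem' := by
    refine ⟨0, ⟨fun j y => rfl, fun B _ _ => ⟨MemLp.zero, fun v => ⟨0, hasWeakDeriv_zero _ _⟩⟩⟩,
      fun j => ?_⟩
    exact (hasWeakDeriv_zero _ _).congr_ae .rfl (Lp.coeFn_zero _ _ _).symm
  smul_mem' := by
    rintro c a ⟨φ, hφ, ha⟩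
    refine ⟨c • φ, ⟨fun j y => by simp [hφ.1], fun B hB hB' => (hφ.2 B hB hB').const_smul c⟩,
      fun j => ?_⟩
    exact ((ha j).const_smul c).congr_ae .rfl (Lp.coeFn_smul _ _).symm

/-- The columns of a `3 × 2` matrix, completed by a zero column. -/
def columns : Matrix (Fin 3) (Fin 2) ℝ →ₗ[ℝ] (Fin 3 → Vec3) where
  toFun ξ := ![WithLp.toLp 2 fun i => ξ i 0, WithLp.toLp 2 fun i => ξ i 1, 0]
  map_add' ξ ζ := by
    ext j i
    fin_cases j <;> simp
  map_smul' c ξ := by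
    ext j i
    fin_cases j <;> simp

variable [IsFiniteMeasure ((volume : Measure Space).restrict (cell f₁ f₂))]

/-- The constant fields on the cell. -/
def constField : Matrix (Fin 3) (Fin 2) ℝ →ₗ[ℝ] CellFields f₁ f₂ where
  toFun ξ := WithLp.toLp 2 fun j =>
    Lp.constL 2 ((volume : Measure Space).restrict (cell f₁ f₂)) ℝ (columns ξ j)
  map_add' ξ ζ := by
    ext1 j
    simp
  map_smul' c ξ := by
    ext1 j
    simp

/-- The optimal flux of the cell problem. -/
def flux : Matrix (Fin 3) (Fin 2) ℝ →ₗ[ℝ] CellFields f₁ f₂ :=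
  orthogonalPart (gradSpace f₁ f₂) ∘ₗ constField f₁ f₂

theorem flux_mem (ξ : Matrix (Fin 3) (Fin 2) ℝ) : flux f₁ f₂ ξ ∈ (gradSpace f₁ f₂)ᗮ :=
  orthogonalPart_mem _ _

theorem constField_apply (ξ : Matrix (Fin 3) (Fin 2) ℝ) (j : Fin 3) :
    constField f₁ f₂ ξ j =ᵐ[volume.restrict (cell f₁ f₂)] fun _ => columns ξ j :=
  Lp.coeFn_const _ _ _

variable {f₁ f₂}

theorem norm_sq_cellFields (a : CellFields f₁ f₂) :
    ‖a‖ ^ 2 = ∫ y in cell f₁ f₂, ∑ j, ‖a j y‖ ^ 2 := by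
  rw [PiLp.norm_sq_eq_of_L2,
    integral_finsetSum _ fun j _ => (Lp.memLp (a j)).integrable_norm_pow two_ne_zero]
  refine Finset.sum_congr rfl fun j _ => ?_
  rw [← real_inner_self_eq_norm_sq, L2.inner_def]
  simp

theorem gHom_le (h₁ : Continuous f₁) (h₂ : Continuous f₂) (ξ : Matrix (Fin 3) (Fin 2) ℝ) :
    gHom f₁ f₂ ξ ≤ ‖flux f₁ f₂ ξ‖ ^ 2 := by
  have key : ∀ b ∈ gradSpace f₁ f₂, gHom f₁ f₂ ξ ≤ ‖constField f₁ f₂ ξ + b‖ ^ 2 := by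
    rintro b ⟨φ, hφ, hb⟩
    refine (ciInf_le ⟨0, ?_⟩ (⟨φ, hφ⟩ : {φ : Space → Vec3 // MemH1Per f₁ f₂ φ})).trans_eq ?_
    · rintro _ ⟨ψ, rfl⟩
      exact integral_nonneg fun y => by
        unfold frobSq
        positivity
    · rw [norm_sq_cellFields]
      refine integral_congr_ae ?_
      have hH : MemH1 (cell f₁ f₂) φ := hφ.2 _ isOpen_unitSquare isBounded_unitSquare
      have hopen : IsOpen (cell f₁ f₂) := isOpen_between isOpen_unitSquare h₁ h₂
      have hu : ∀ j, weakDeriv (cell f₁ f₂) φ (axis j) =ᵐ[volume.restrict (cell f₁ f₂)] b j :=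
        fun j => (hH.hasWeakDeriv _).ae_unique hopen (hb j)
      filter_upwards [hu 0, hu 1, hu 2, constField_apply f₁ f₂ ξ 0, constField_apply f₁ f₂ ξ 1,
        constField_apply f₁ f₂ ξ 2, Lp.coeFn_add (constField f₁ f₂ ξ 0) (b 0),
        Lp.coeFn_add (constField f₁ f₂ ξ 1) (b 1), Lp.coeFn_add (constField f₁ f₂ ξ 2) (b 2)]
        with y u0 u1 u2 c0 c1 c2 a0 a1 a2
      simp only [PiLp.add_apply, Fin.sum_univ_three, a0, a1, a2, Pi.add_apply, c0, c1, c2, ← u0,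
        ← u1, ← u2]
      simp only [frobSq, gradPlane, derivVert, EuclideanSpace.real_norm_sq_eq, columns, axis]
      simp [Fin.sum_univ_three]
      ring
  have hs : √(gHom f₁ f₂ ξ) ≤ ‖flux f₁ f₂ ξ‖ := by
    refine le_of_forall_pos_le_add fun δ hδ => ?_
    obtain ⟨a, ha, had⟩ := exists_norm_sub_lt (gradSpace f₁ f₂) (constField f₁ f₂ ξ) hδ
    have hk := key (-a) (neg_mem ha)
    rw [← sub_eq_add_neg] at hk
    exact Real.sqrt_le_iff.2 ⟨by positivity, hk.trans (pow_le_pow_left₀ (norm_nonneg _) had.le 2)⟩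
  exact (Real.sqrt_le_left (norm_nonneg _)).1 hs

end CellProblem

theorem integrable_inner_of_memLp_two {α : Type*} {mα : MeasurableSpace α} {μ : Measure α}
    {u v : α → Vec3} (hu : MemLp u 2 μ) (hv : MemLp v 2 μ) :
    Integrable (fun x => inner ℝ (u x) (v x)) μ :=
  (hu.norm.integrable_mul hv.norm).mono' (hu.1.inner hv.1)
    (Eventually.of_forall fun x => norm_inner_le_norm (u x) (v x))

/-- Periodic fields on the strip that are orthogonal to all gradients of laterally bounded
support. -/
structure IsDualField (f₁ f₂ : Plane → ℝ) (s : Fin 3 → Space → Vec3) : Prop where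
  measurable : ∀ j, Measurable (s j)
  periodic : ∀ j, LatticePeriodic (s j)
  eq_zero : ∀ j, ∀ y ∉ strip f₁ f₂, s j y = 0
  memLp : ∀ j, MemLp (s j) 2 (volume.restrict column)
  orthogonal : ∀ v w R, HasGrad (strip f₁ f₂) v w →
    (∀ y : Space, R < ‖y.1‖ → v y = 0 ∧ ∀ j, w j y = 0) →
    ∫ y, ∑ j, inner ℝ (s j y) (w j y) = 0

theorem memLp_ball {s : Space → Vec3} (hm : Measurable s) (hp : LatticePeriodic s)
    (hs : MemLp s 2 (volume.restrict column)) (R : ℝ) :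
    MemLp s 2 (volume.restrict {y : Space | ‖y.1‖ ≤ R}) := by
  have h1 : IntegrableOn (fun y => ‖s y‖ ^ 2) column := hs.integrable_norm_pow two_ne_zero
  have h2 := integrableOn_ball (by fun_prop) (hp.comp fun x => ‖x‖ ^ 2) h1 R
  exact (memLp_two_iff_integrable_sq_norm hm.aestronglyMeasurable).2 h2

theorem measurableSet_ball_fst (R : ℝ) : MeasurableSet {y : Space | ‖y.1‖ ≤ R} :=
  measurableSet_le (by fun_prop) measurable_const

section Periodize

variable {f₁ f₂ : Plane → ℝ}

/-- The lattice-periodic sum of a function with laterally bounded support. -/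
def periodize (v : Space → Vec3) (y : Space) : Vec3 := ∑ᶠ g : lattice, v (g + y)

theorem periodize_eq_sum {v : Space → Vec3} {R ρ : ℝ} (hv : ∀ y : Space, R < ‖y.1‖ → v y = 0)
    {T : Finset lattice} (hT : ∀ g : lattice, ‖(g : Space).1‖ ≤ R + ρ → g ∈ T) {y : Space}
    (hy : ‖y.1‖ ≤ ρ) : periodize v y = ∑ g ∈ T, v (g + y) := by
  refine finsum_eq_sum_of_support_subset _ fun g hg => hT g ?_
  have h1 : ‖((g : Space) + y).1‖ ≤ R := by
    by_contra h
    exact hg (hv _ (not_le.1 h))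
  have h2 := norm_sub_le ((g : Space) + y).1 y.1
  rw [Prod.fst_add, add_sub_cancel_right] at h2
  rw [Prod.fst_add] at h1
  linarith

theorem periodize_periodic (v : Space → Vec3) : LatticePeriodic (periodize v) := by
  intro g hg y
  unfold periodize
  simp only [← add_assoc]
  exact finsum_comp_equiv (Equiv.addRight (⟨g, hg⟩ : lattice)) (f := fun l => v (l + y))

theorem HasWeakDeriv.translate (h₁ : IsPeriodic f₁) (h₂ : IsPeriodic f₂) {v w : Space → Vec3}
    {d : Space} (h : HasWeakDeriv (strip f₁ f₂) v d w) (g : lattice) :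
    HasWeakDeriv (strip f₁ f₂) (fun y => v (g + y)) d fun y => w (g + y) := by
  have h3 := h.comp_add (g : Space)
  have : (fun y => y + (g : Space)) ⁻¹' strip f₁ f₂ = strip f₁ f₂ := by
    ext y
    rw [Set.mem_preimage, add_comm]
    exact iff_of_eq (latticePeriodic_mem_strip h₁ h₂ g g.2 y)
  rw [this] at h3
  simpa only [add_comm] using h3

theorem hasGrad_periodize (hc₁ : Continuous f₁) (hc₂ : Continuous f₂) (h₁ : IsPeriodic f₁)
    (h₂ : IsPeriodic f₂) {v : Space → Vec3} {w : Fin 3 → Space → Vec3} {R : ℝ}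
    (h : HasGrad (strip f₁ f₂) v w) (hv : ∀ y : Space, R < ‖y.1‖ → v y = 0 ∧ ∀ j, w j y = 0)
    {B : Set Plane} (hB : IsOpen B) (hB' : Bornology.IsBounded B) :
    HasGrad (between B f₁ f₂) (periodize v) fun j => periodize (w j) := by
  intro j
  obtain ⟨ρ, hρ⟩ := hB'.exists_norm_le
  set T := (finite_lattice_norm_le (R + ρ)).toFinset
  have hT : ∀ g : lattice, ‖(g : Space).1‖ ≤ R + ρ → g ∈ T := fun g hg => by simpa [T] using hg
  have hsub : between B f₁ f₂ ⊆ strip f₁ f₂ := fun y hy => ⟨trivial, hy.2⟩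
  have hS := (hasWeakDeriv_sum T fun g _ => (h j).translate h₁ h₂ g).mono hsub
    (isOpen_between isOpen_univ hc₁ hc₂).measurableSet
  have hm := (isOpen_between hB hc₁ hc₂).measurableSet
  refine hS.congr_ae ?_ ?_
  · filter_upwards [ae_restrict_mem hm] with y hy
    rw [periodize_eq_sum (fun y hy => (hv y hy).1) hT (hρ _ hy.1), Finset.sum_apply]
  · filter_upwards [ae_restrict_mem hm] with y hy
    rw [periodize_eq_sum (fun y hy => (hv y hy).2 j) hT (hρ _ hy.1), Finset.sum_apply]

theorem memH1Per_periodize (hc₁ : Continuous f₁) (hc₂ : Continuous f₂) (h₁ : IsPeriodic f₁)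
    (h₂ : IsPeriodic f₂) {v : Space → Vec3} {w : Fin 3 → Space → Vec3} {R : ℝ}
    (h : HasGrad (strip f₁ f₂) v w) (hv : ∀ y : Space, R < ‖y.1‖ → v y = 0 ∧ ∀ j, w j y = 0) :
    MemH1Per f₁ f₂ (periodize v) := by
  refine ⟨fun j y => ?_, fun B hB hB' => (hasGrad_periodize hc₁ hc₂ h₁ h₂ h hv hB hB').memH1⟩
  have hmem : (EuclideanSpace.single j (1 : ℝ), (0 : ℝ)) ∈ lattice := by
    refine ⟨fun i => ?_, rfl⟩
    by_cases hij : i = j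
    · exact ⟨1, by simp [hij]⟩
    · exact ⟨0, by simp [hij]⟩
  rw [add_comm]
  exact periodize_periodic v _ hmem y

/-- The periodic extension of a field on the cell, by zero off the strip. -/
def extend (f₁ f₂ : Plane → ℝ) (a : CellFields f₁ f₂) (j : Fin 3) : Space → Vec3 :=
  (strip f₁ f₂).indicator fun y => a j (fractPart y)

variable (a : CellFields f₁ f₂)

theorem measurable_extend (hc₁ : Continuous f₁) (hc₂ : Continuous f₂) (j : Fin 3) :
    Measurable (extend f₁ f₂ a j) :=
  ((Lp.stronglyMeasurable (a j)).measurable.comp measurable_fractPart).indicator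
    (isOpen_between isOpen_univ hc₁ hc₂).measurableSet

theorem extend_periodic (h₁ : IsPeriodic f₁) (h₂ : IsPeriodic f₂) (j : Fin 3) :
    LatticePeriodic (extend f₁ f₂ a j) := by
  intro g hg y
  have h := iff_of_eq (latticePeriodic_mem_strip h₁ h₂ g hg y)
  by_cases hy : y ∈ strip f₁ f₂
  · rw [extend, Set.indicator_of_mem hy, Set.indicator_of_mem (h.2 hy), fractPart_add hg]
  · rw [extend, Set.indicator_of_notMem hy, Set.indicator_of_notMem fun h' => hy (h.1 h')]

theorem extend_eq_zero (j : Fin 3) (y : Space) (hy : y ∉ strip f₁ f₂) :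
    extend f₁ f₂ a j y = 0 := Set.indicator_of_notMem hy _

theorem extend_eq_of_mem_cell (j : Fin 3) {y : Space} (hy : y ∈ cell f₁ f₂) :
    extend f₁ f₂ a j y = a j y := by
  have h1 : y ∈ strip f₁ f₂ := ⟨trivial, hy.2⟩
  have h2 : y ∈ column := unitSquare_subset_base hy.1
  rw [extend, Set.indicator_of_mem h1, fractPart_of_mem h2]

theorem measurableSet_cell (hc₁ : Continuous f₁) (hc₂ : Continuous f₂) :
    MeasurableSet (cell f₁ f₂) :=
  (isOpen_between isOpen_unitSquare hc₁ hc₂).measurableSet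

theorem memLp_extend (hc₁ : Continuous f₁) (hc₂ : Continuous f₂) (j : Fin 3) :
    MemLp (extend f₁ f₂ a j) 2 (volume.restrict column) := by
  rw [extend, memLp_indicator_iff_restrict (isOpen_between isOpen_univ hc₁ hc₂).measurableSet,
    ← restrict_cell hc₁ hc₂]
  refine (Lp.memLp (a j)).ae_eq ?_
  filter_upwards [ae_restrict_mem (measurableSet_cell hc₁ hc₂)] with y hy
  have h2 : y ∈ column := unitSquare_subset_base hy.1
  rw [fractPart_of_mem h2]

theorem setIntegral_column {X : Type*} [NormedAddCommGroup X] [NormedSpace ℝ X]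
    (hc₁ : Continuous f₁) (hc₂ : Continuous f₂) {h : Space → X}
    (hh : ∀ y ∉ strip f₁ f₂, h y = 0) : ∫ y in column, h y = ∫ y in cell f₁ f₂, h y := by
  rw [restrict_cell hc₁ hc₂]
  exact (setIntegral_eq_integral_of_forall_compl_eq_zero hh).symm

theorem isDualField_extend (hc₁ : Continuous f₁) (hc₂ : Continuous f₂) (h₁ : IsPeriodic f₁)
    (h₂ : IsPeriodic f₂) (ha : a ∈ (gradSpace f₁ f₂)ᗮ) : IsDualField f₁ f₂ (extend f₁ f₂ a) where
  measurable := measurable_extend a hc₁ hc₂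
  periodic := extend_periodic a h₁ h₂
  eq_zero := extend_eq_zero a
  memLp := memLp_extend a hc₁ hc₂
  orthogonal := by
    intro v w R hvw hv
    set s := extend f₁ f₂ a with hs
    have hSm : MeasurableSet (strip f₁ f₂) := (isOpen_between isOpen_univ hc₁ hc₂).measurableSet
    set f : Space → ℝ := fun y => ∑ j, inner ℝ (s j y) (w j y) with hf
    have hf0 : ∀ y : Space, R < ‖y.1‖ → f y = 0 := fun y hy => by
      simp [hf, (hv y hy).2]
    have hfi : Integrable f := by
      refine integrable_finsetSum _ fun j _ => ?_
      have hsub : Function.support (fun y => inner ℝ (s j y) (w j y))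
          ⊆ {y : Space | ‖y.1‖ ≤ R} ∩ strip f₁ f₂ := by
        intro y hy
        constructor
        · by_contra h
          exact hy (by simp [(hv y (not_le.1 h)).2 j])
        · by_contra h
          exact hy (by simp [hs, extend_eq_zero a j y h])
      rw [← integrableOn_iff_integrable_of_support_subset hsub]
      refine integrable_inner_of_memLp_two ?_ ?_
      · exact (memLp_ball (measurable_extend a hc₁ hc₂ j) (extend_periodic a h₁ h₂ j)
          (memLp_extend a hc₁ hc₂ j) R).mono_measure
          (Measure.restrict_mono Set.inter_subset_left le_rfl)
      · exact (hvw j).2.1.mono_measure (Measure.restrict_mono Set.inter_subset_right le_rfl)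
    set T := (finite_lattice_norm_le (R + 2)).toFinset
    have hT : ∀ g : lattice, ‖(g : Space).1‖ ≤ R + 2 → g ∈ T := fun g hg => by
      simpa [T] using hg
    rw [isAddFundamentalDomain_column.integral_eq_tsum'' f hfi, tsum_eq_sum (s := T)]
    · have e1 : ∀ g : lattice, IntegrableOn (fun y => f (g +ᵥ y)) column := fun g =>
        (hfi.comp_add_left (g : Space)).integrableOn
      rw [← integral_finsetSum _ fun g _ => e1 g]
      have hG := hasGrad_periodize hc₁ hc₂ h₁ h₂ hvw hv isOpen_unitSquare isBounded_unitSquare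
      have hP := memH1Per_periodize hc₁ hc₂ h₁ h₂ hvw hv
      set b : CellFields f₁ f₂ := WithLp.toLp 2 fun j => (hG j).2.1.toLp (periodize (w j))
      have hb : b ∈ gradSpace f₁ f₂ :=
        ⟨periodize v, hP, fun j => (hG j).congr_ae .rfl (MemLp.coeFn_toLp (hG j).2.1).symm⟩
      have hin := (Submodule.mem_orthogonal _ _).1 ha b hb
      rw [setIntegral_column hc₁ hc₂, ← hin, real_inner_comm, PiLp.inner_apply]
      · simp only [L2.inner_def]
        rw [← integral_finsetSum _ fun j _ => L2.integrable_inner _ _]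
        refine integral_congr_ae ?_
        have hbj : ∀ j, b j =ᵐ[volume.restrict (cell f₁ f₂)] periodize (w j) := fun j =>
          MemLp.coeFn_toLp (hG j).2.1
        filter_upwards [hbj 0, hbj 1, hbj 2, ae_restrict_mem (measurableSet_cell hc₁ hc₂)]
          with y b0 b1 b2 hy
        have hy2 : ‖y.1‖ ≤ 2 := norm_le_of_mem_base (unitSquare_subset_base hy.1)
        have hp : ∀ j, periodize (w j) y = ∑ g ∈ T, w j (g + y) := fun j =>
          periodize_eq_sum (fun y hy => (hv y hy).2 j) hT hy2
        have hsg : ∀ (g : lattice) j, s j (g +ᵥ y) = a j y := fun g j => by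
          rw [← extend_eq_of_mem_cell a j hy]
          exact extend_periodic a h₁ h₂ j g g.2 y
        simp only [hf, hsg]
        rw [Finset.sum_comm]
        simp only [Fin.sum_univ_three, b0, b1, b2, hp, inner_sum]
        rfl
      · intro y hy
        refine Finset.sum_eq_zero fun g _ => Finset.sum_eq_zero fun j _ => ?_
        have : s j (g +ᵥ y) = 0 := by
          rw [← extend_eq_zero a j y hy]
          exact extend_periodic a h₁ h₂ j g g.2 y
        rw [this, inner_zero_left]
    · intro g hg
      refine setIntegral_eq_zero_of_forall_eq_zero fun y hy => hf0 _ ?_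
      have h1 : R + 2 < ‖(g : Space).1‖ := by
        by_contra h
        exact hg (hT g (not_lt.1 h))
      have h2 : ‖y.1‖ ≤ 2 := norm_le_of_mem_base hy
      have h3 := norm_sub_le ((g : Space) + y).1 y.1
      rw [Prod.fst_add, add_sub_cancel_right, ← Prod.fst_add] at h3
      change R < ‖((g : Space) + y).1‖
      linarith

theorem integral_inner_extend (hc₁ : Continuous f₁) (hc₂ : Continuous f₂)
    (a b : CellFields f₁ f₂) :
    ∫ y in column, ∑ j, inner ℝ (extend f₁ f₂ a j y) (extend f₁ f₂ b j y) = inner ℝ a b := by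
  rw [setIntegral_column hc₁ hc₂, PiLp.inner_apply]
  · simp only [L2.inner_def]
    rw [← integral_finsetSum _ fun j _ => L2.integrable_inner _ _]
    refine setIntegral_congr_fun (measurableSet_cell hc₁ hc₂) fun y hy => ?_
    simp only [extend_eq_of_mem_cell _ _ hy]
  · intro y hy
    simp [extend_eq_zero _ _ y hy]

theorem inner_constField [IsFiniteMeasure ((volume : Measure Space).restrict (cell f₁ f₂))]
    (hc₁ : Continuous f₁) (hc₂ : Continuous f₂) (ξ : Matrix (Fin 3) (Fin 2) ℝ)
    (a : CellFields f₁ f₂) :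
    inner ℝ (constField f₁ f₂ ξ) a
      = ∑ j, inner ℝ (columns ξ j) (∫ y in column, extend f₁ f₂ a j y) := by
  rw [PiLp.inner_apply]
  refine Finset.sum_congr rfl fun j _ => ?_
  rw [setIntegral_column hc₁ hc₂ (extend_eq_zero a j), L2.inner_def,
    setIntegral_congr_fun (g := a j) (measurableSet_cell hc₁ hc₂)
      fun y hy => extend_eq_of_mem_cell _ _ hy,
    ← integral_inner ((Lp.memLp (a j)).integrable one_le_two)]
  refine integral_congr_ae ?_
  filter_upwards [constField_apply f₁ f₂ ξ j] with y hy
  rw [hy]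

end Periodize

section Cutoff

variable {E F : Type*} [NormedAddCommGroup E] [NormedSpace ℝ E] [MeasureSpace E]
  [NormedAddCommGroup F] [NormedSpace ℝ F]

theorem memLp_of_subset_of_eq_zero {α : Type*} {mα : MeasurableSpace α} {μ : Measure α}
    {U W : Set α} (hU : MeasurableSet U) (hUW : U ⊆ W) {g : α → F}
    (hg : MemLp g 2 (μ.restrict U)) (h0 : ∀ x ∉ U, g x = 0) : MemLp g 2 (μ.restrict W) := by
  have e : U.indicator g = g := by
    ext x
    by_cases hx : x ∈ U
    · rw [Set.indicator_of_mem hx]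
    · rw [Set.indicator_of_notMem hx, h0 x hx]
  rw [← e, memLp_indicator_iff_restrict hU, Measure.restrict_restrict hU,
    Set.inter_eq_left.2 hUW]
  exact hg

variable [BorelSpace E] [FiniteDimensional ℝ E] [(volume : Measure E).IsAddHaarMeasure]

/-- Product rule with a smooth cutoff that localizes from `W` to `U`. -/
theorem HasWeakDeriv.cutoff {U W : Set E} (hU : IsOpen U) (hUW : U ⊆ W) {u : E → F} {v : E}
    {w : E → F} (h : HasWeakDeriv U u v w) {χ : E → ℝ} (hχ : ContDiff ℝ (⊤ : ℕ∞) χ)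
    (hs : tsupport χ ∩ W ⊆ U) (hu0 : ∀ x ∉ U, χ x • u x = 0)
    (hw0 : ∀ x ∉ U, χ x • w x + fderiv ℝ χ x v • u x = 0) {C : ℝ} (hC : ∀ x, ‖χ x‖ ≤ C)
    {C' : ℝ} (hC' : ∀ x, ‖fderiv ℝ χ x v‖ ≤ C') :
    HasWeakDeriv W (fun x => χ x • u x) v fun x => χ x • w x + fderiv ℝ χ x v • u x := by
  have hm : ∀ {a : E → ℝ} {g : E → F} {K : ℝ}, Continuous a → (∀ x, ‖a x‖ ≤ K) →
      MemLp g 2 (volume.restrict U) → MemLp (fun x => a x • g x) 2 (volume.restrict U) := by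
    intro a g K ha hK hg
    refine hg.of_le_mul (c := K) (ha.aestronglyMeasurable.smul hg.1)
      (Eventually.of_forall fun x => ?_)
    rw [norm_smul]
    gcongr
    exact hK x
  have hd : Continuous fun x => fderiv ℝ χ x v := continuous_fderiv_apply hχ v
  have m1 := hm hχ.continuous hC h.1
  have m2 := hm hχ.continuous hC h.2.1
  have m3 := hm hd hC' h.1
  refine ⟨memLp_of_subset_of_eq_zero hU.measurableSet hUW m1 hu0,
    memLp_of_subset_of_eq_zero hU.measurableSet hUW (m2.add m3) hw0, fun φ hφ hc hφW => ?_⟩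
  have hres : ∀ {g : E → F}, (∀ x ∉ U, g x = 0) → ∫ x in W, g x = ∫ x in U, g x := by
    intro g hg
    rw [setIntegral_eq_integral_of_forall_compl_eq_zero hg]
    exact setIntegral_eq_integral_of_forall_compl_eq_zero fun x hx => hg x fun h => hx (hUW h)
  rw [hres fun x hx => by simp only [hu0 x hx, smul_zero],
    hres fun x hx => by simp only [hw0 x hx, smul_zero]]
  have hp : ContDiff ℝ (⊤ : ℕ∞) fun x => φ x * χ x := hφ.mul hχ
  have hpc : HasCompactSupport fun x => φ x * χ x := hc.mul_right
  have hps : tsupport (fun x => φ x * χ x) ⊆ U := fun x hx =>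
    hs ⟨tsupport_mul_subset_right hx, hφW (tsupport_mul_subset_left hx)⟩
  have key := h.2.2 _ hp hpc hps
  have hfd : ∀ x, fderiv ℝ (fun x => φ x * χ x) x v
      = fderiv ℝ φ x v * χ x + φ x * fderiv ℝ χ x v := by
    intro x
    have h1 : DifferentiableAt ℝ φ x := hφ.differentiable (by simp) x
    have h2 : DifferentiableAt ℝ χ x := hχ.differentiable (by simp) x
    rw [show (fun x => φ x * χ x) = φ * χ from rfl, fderiv_mul h1 h2]
    simp
    ring
  simp only [hfd, add_smul, mul_smul] at key
  rw [integral_add (integrable_fderiv_smul hφ hc v m1)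
    (integrable_test_smul hφ.continuous hc m3)] at key
  simp only [smul_add]
  rw [integral_add (integrable_test_smul hφ.continuous hc m2)
    (integrable_test_smul hφ.continuous hc m3), neg_add, ← key]
  abel

end Cutoff

section Duality

variable {f₁ f₂ : Plane → ℝ}

theorem fderiv_comp_fst {χ : Plane → ℝ} (hχ : ContDiff ℝ (⊤ : ℕ∞) χ) (y v : Space) :
    fderiv ℝ (fun y : Space => χ y.1) y v = fderiv ℝ χ y.1 v.1 := by
  have h1 : HasFDerivAt χ (fderiv ℝ χ y.1) y.1 := (hχ.differentiable (by simp) _).hasFDerivAt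
  have h2 := h1.comp y (hasFDerivAt_fst (𝕜 := ℝ) (p := y))
  exact (congrArg (fun L : Space →L[ℝ] ℝ => L v) h2.fderiv)

theorem eq_zero_of_notMem {χ : Plane → ℝ} {O : Set Plane} (hs : tsupport χ ⊆ O) {x : Plane}
    (hx : x ∉ O) : χ x = 0 := by
  by_contra h0
  exact hx (hs (subset_tsupport _ h0))

theorem fderiv_eq_zero_of_notMem {χ : Plane → ℝ} {O : Set Plane} (hs : tsupport χ ⊆ O) {x : Plane}
    (hx : x ∉ O) : fderiv ℝ χ x = 0 := by
  by_contra h0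
  exact hx (hs (support_fderiv_subset ℝ h0))

/-- Multiplication by a horizontal cutoff, set to zero off the region over `O`. -/
theorem HasGrad.cutoff (hc₁ : Continuous f₁) (hc₂ : Continuous f₂) {O : Set Plane} (hO : IsOpen O)
    {n : Space → Vec3} {w : Fin 3 → Space → Vec3} (h : HasGrad (between O f₁ f₂) n w)
    {χ : Plane → ℝ} (hχ : ContDiff ℝ (⊤ : ℕ∞) χ) (hc : HasCompactSupport χ)
    (hs : tsupport χ ⊆ O) :
    HasGrad (strip f₁ f₂)
      ((between O f₁ f₂).indicator fun y => χ y.1 • n y)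
      fun j => (between O f₁ f₂).indicator fun y =>
        χ y.1 • w j y + fderiv ℝ χ y.1 (axis j).1 • n y := by
  intro j
  have hU := isOpen_between hO hc₁ hc₂
  set U := between O f₁ f₂ with hUdef
  have hsub : U ⊆ strip f₁ f₂ := fun y hy => ⟨trivial, hy.2⟩
  have h' : HasWeakDeriv U (U.indicator n) (axis j) (U.indicator (w j)) :=
    (h j).congr_ae (indicator_ae_eq_restrict hU.measurableSet).symm
      (indicator_ae_eq_restrict hU.measurableSet).symm
  obtain ⟨C, hC⟩ := hχ.continuous.bounded_above_of_compact_support hc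
  obtain ⟨C', hC'⟩ := (continuous_fderiv_apply hχ (axis j).1).bounded_above_of_compact_support
    (hasCompactSupport_fderiv_apply' hc (axis j).1)
  have hts : tsupport (fun y : Space => χ y.1) ⊆ Prod.fst ⁻¹' tsupport χ :=
    tsupport_comp_subset_preimage χ continuous_fst
  have key := h'.cutoff hU hsub (χ := fun y => χ y.1) (hχ.comp contDiff_fst)
    (fun y hy => ⟨hs (hts hy.1), hy.2.2⟩)
    (fun y hy => by rw [Set.indicator_of_notMem hy, smul_zero])
    (fun y hy => by rw [Set.indicator_of_notMem hy, Set.indicator_of_notMem hy, smul_zero,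
      smul_zero, add_zero])
    (C := C) (fun y => hC y.1) (C' := C') (fun y => by rw [fderiv_comp_fst hχ]; exact hC' y.1)
  convert key using 1
  · ext1 y
    by_cases hy : y ∈ U
    · simp [Set.indicator_of_mem hy]
    · simp [Set.indicator_of_notMem hy]
  · ext1 y
    rw [fderiv_comp_fst hχ]
    by_cases hy : y ∈ U
    · simp [Set.indicator_of_mem hy]
    · simp [Set.indicator_of_notMem hy]

theorem hasCompactSupport_bound {χ : Plane → ℝ} (hc : HasCompactSupport χ) :
    ∃ R, ∀ x, R < ‖x‖ → χ x = 0 := by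
  obtain ⟨R, hR⟩ := hc.isCompact.isBounded.exists_norm_le
  exact ⟨R, fun x hx => eq_zero_of_notMem (O := Metric.closedBall 0 R)
    (fun y hy => by simpa using hR y hy) (by simpa using hx)⟩

/-- A compactly supported horizontal weight times a periodic square-integrable field. -/
theorem memLp_weight {s : Space → Vec3} (hm : Measurable s) (hp : LatticePeriodic s)
    (hs : MemLp s 2 (volume.restrict column)) {χ : Plane → ℝ} (hχ : Continuous χ)
    (hc : HasCompactSupport χ) : MemLp (fun y => χ y.1 • s y) 2 volume := by
  obtain ⟨R, hR⟩ := hasCompactSupport_bound hc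
  obtain ⟨C, hC⟩ := hχ.bounded_above_of_compact_support hc
  have h1 : MemLp (fun y => χ y.1 • s y) 2 (volume.restrict {y : Space | ‖y.1‖ ≤ R}) := by
    refine (memLp_ball hm hp hs R).of_le_mul (c := C)
      ((hχ.comp continuous_fst).aestronglyMeasurable.smul hm.aestronglyMeasurable)
      (Eventually.of_forall fun y => ?_)
    rw [norm_smul]
    gcongr
    exact hC y.1
  have h2 := memLp_of_subset_of_eq_zero (measurableSet_ball_fst R) (Set.subset_univ _) h1
    fun y hy => by rw [hR _ (not_le.1 hy), zero_smul]
  rwa [Measure.restrict_univ] at h2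

theorem integrable_weight {s : Space → Vec3} (hm : Measurable s) (hp : LatticePeriodic s)
    (hs : MemLp s 2 (volume.restrict column)) {χ : Plane → ℝ} (hχ : Continuous χ)
    (hc : HasCompactSupport χ) {U : Set Space} {u : Space → Vec3}
    (hu : MemLp u 2 (volume.restrict U)) :
    Integrable (fun y => χ y.1 * inner ℝ (s y) (u y)) (volume.restrict U) := by
  have := integrable_inner_of_memLp_two ((memLp_weight hm hp hs hχ hc).restrict U) hu
  simpa only [real_inner_smul_left] using this

/-- Integration by parts against a dual field. -/
theorem IsDualField.integral_grad (hc₁ : Continuous f₁) (hc₂ : Continuous f₂)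
    {s : Fin 3 → Space → Vec3} (hs : IsDualField f₁ f₂ s) {O : Set Plane} (hO : IsOpen O)
    {n : Space → Vec3} {w : Fin 3 → Space → Vec3} (h : HasGrad (between O f₁ f₂) n w)
    {χ : Plane → ℝ} (hχ : ContDiff ℝ (⊤ : ℕ∞) χ) (hc : HasCompactSupport χ)
    (hχs : tsupport χ ⊆ O) :
    ∑ j, ∫ y in between O f₁ f₂, χ y.1 * inner ℝ (s j y) (w j y)
      = - ∑ j, ∫ y in between O f₁ f₂, fderiv ℝ χ y.1 (axis j).1 * inner ℝ (s j y) (n y) := by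
  obtain ⟨R, hR⟩ := hasCompactSupport_bound hc
  have hU := (isOpen_between hO hc₁ hc₂).measurableSet
  have hR' : ∀ (j : Fin 3) (x : Plane), R < ‖x‖ → fderiv ℝ χ x (axis j).1 = 0 := by
    intro j x hx
    have hsub : tsupport χ ⊆ Metric.closedBall 0 R := by
      refine closure_minimal (fun y hy => ?_) Metric.isClosed_closedBall
      by_contra h
      exact hy (hR _ (by simpa using h))
    rw [fderiv_eq_zero_of_notMem hsub (by simpa using hx)]
    rfl
  have key := hs.orthogonal _ _ R (h.cutoff hc₁ hc₂ hO hχ hc hχs) fun y hy => by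
    refine ⟨?_, fun j => ?_⟩ <;>
    · by_cases hyU : y ∈ between O f₁ f₂
      · rw [Set.indicator_of_mem hyU]
        simp [hR _ hy, hR' _ _ hy]
      · rw [Set.indicator_of_notMem hyU]
  have e : ∀ y, ∑ j, inner ℝ (s j y) ((between O f₁ f₂).indicator
      (fun y => χ y.1 • w j y + fderiv ℝ χ y.1 (axis j).1 • n y) y)
      = (between O f₁ f₂).indicator (fun y => ∑ j, (χ y.1 * inner ℝ (s j y) (w j y)
        + fderiv ℝ χ y.1 (axis j).1 * inner ℝ (s j y) (n y))) y := by
    intro y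
    by_cases hyU : y ∈ between O f₁ f₂
    · simp [Set.indicator_of_mem hyU, inner_add_right, real_inner_smul_right]
    · simp [Set.indicator_of_notMem hyU]
  have i1 : ∀ j, Integrable (fun y => χ y.1 * inner ℝ (s j y) (w j y))
      (volume.restrict (between O f₁ f₂)) := fun j =>
    integrable_weight (hs.measurable j) (hs.periodic j) (hs.memLp j) hχ.continuous hc (h j).2.1
  have i2 : ∀ j, Integrable (fun y => fderiv ℝ χ y.1 (axis j).1 * inner ℝ (s j y) (n y))
      (volume.restrict (between O f₁ f₂)) := fun j =>
    integrable_weight (χ := fun x => fderiv ℝ χ x (axis j).1) (hs.measurable j) (hs.periodic j)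
      (hs.memLp j) (continuous_fderiv_apply hχ _) (hasCompactSupport_fderiv_apply' hc _) (h j).1
  simp only [e] at key
  rw [integral_indicator hU, integral_finsetSum (f := fun j y => χ y.1 * inner ℝ (s j y) (w j y)
    + fderiv ℝ χ y.1 (axis j).1 * inner ℝ (s j y) (n y)) _ fun j _ => (i1 j).add (i2 j)] at key
  simp only [integral_add (i1 _) (i2 _)] at key
  rw [Finset.sum_add_distrib] at key
  linarith

/-- The dual lower bound for the energy on the region over `O`. -/
theorem energy_lower_bound {P : Type*} [Fintype P] (hc₁ : Continuous f₁) (hc₂ : Continuous f₂)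
    {s : P → Fin 3 → Space → Vec3} (hs : ∀ p, IsDualField f₁ f₂ (s p)) {O : Set Plane}
    (hO : IsOpen O) {n : Space → Vec3} {w : Fin 3 → Space → Vec3}
    (h : HasGrad (between O f₁ f₂) n w) {χ : P → Plane → ℝ}
    (hχ : ∀ p, ContDiff ℝ (⊤ : ℕ∞) (χ p)) (hc : ∀ p, HasCompactSupport (χ p))
    (hχs : ∀ p, tsupport (χ p) ⊆ O) :
    -2 * (∑ p, ∑ j, ∫ y in between O f₁ f₂,
        fderiv ℝ (χ p) y.1 (axis j).1 * inner ℝ (s p j y) (n y))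
      - ∑ p, ∑ q, ∫ y, (χ p y.1 * χ q y.1) * ∑ j, inner ℝ (s p j y) (s q j y)
      ≤ ∫ y in between O f₁ f₂, ∑ j, ‖w j y‖ ^ 2 := by
  set U := between O f₁ f₂ with hUdef
  have hU : MeasurableSet U := (isOpen_between hO hc₁ hc₂).measurableSet
  have hχm : ∀ p j, MemLp (fun y => χ p y.1 • s p j y) 2 volume := fun p j =>
    memLp_weight ((hs p).measurable j) ((hs p).periodic j) ((hs p).memLp j) (hχ p).continuous (hc p)
  have i1 : ∀ p j, Integrable (fun y => χ p y.1 * inner ℝ (s p j y) (w j y)) (volume.restrict U) :=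
    fun p j => integrable_weight ((hs p).measurable j) ((hs p).periodic j) ((hs p).memLp j)
      (hχ p).continuous (hc p) (h j).2.1
  have i2 : ∀ p q j, Integrable (fun y => (χ p y.1 * χ q y.1) * inner ℝ (s p j y) (s q j y))
      volume := fun p q j => by
    have := integrable_inner_of_memLp_two (hχm p j) (hχm q j)
    simp only [real_inner_smul_left, real_inner_smul_right] at this
    refine this.congr (Eventually.of_forall fun y => ?_)
    simp only
    ring
  have i3 : ∀ j, Integrable (fun y => ‖w j y‖ ^ 2) (volume.restrict U) := fun j =>
    (h j).2.1.integrable_norm_pow two_ne_zero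
  have e1 : ∀ p q, ∫ y, (χ p y.1 * χ q y.1) * ∑ j, inner ℝ (s p j y) (s q j y)
      = ∫ y in U, ∑ j, (χ p y.1 * χ q y.1) * inner ℝ (s p j y) (s q j y) := by
    intro p q
    simp only [Finset.mul_sum]
    refine (setIntegral_eq_integral_of_forall_compl_eq_zero fun y hy => ?_).symm
    refine Finset.sum_eq_zero fun j _ => ?_
    by_cases hyO : y.1 ∈ O
    · have : y ∉ strip f₁ f₂ := fun hyS => hy ⟨hyO, hyS.2⟩
      rw [(hs p).eq_zero j y this, inner_zero_left, mul_zero]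
    · rw [eq_zero_of_notMem (hχs p) hyO, zero_mul, zero_mul]
  have e2 : ∀ p, -∑ j, ∫ y in U, fderiv ℝ (χ p) y.1 (axis j).1 * inner ℝ (s p j y) (n y)
      = ∫ y in U, ∑ j, χ p y.1 * inner ℝ (s p j y) (w j y) := by
    intro p
    rw [← (hs p).integral_grad hc₁ hc₂ hO h (hχ p) (hc p) (hχs p),
      integral_finsetSum _ fun j _ => i1 p j]
  have e3 : -2 * ∑ p, ∑ j, ∫ y in U, fderiv ℝ (χ p) y.1 (axis j).1 * inner ℝ (s p j y) (n y)
      = 2 * ∑ p, ∫ y in U, ∑ j, χ p y.1 * inner ℝ (s p j y) (w j y) := by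
    simp only [← e2, Finset.sum_neg_distrib]
    ring
  rw [e3]
  simp only [e1]
  have j1 : Integrable (fun y => ∑ p, ∑ j, χ p y.1 * inner ℝ (s p j y) (w j y))
      (volume.restrict U) :=
    integrable_finsetSum _ fun p _ => integrable_finsetSum _ fun j _ => i1 p j
  have j2 : Integrable (fun y => ∑ p, ∑ q, ∑ j, (χ p y.1 * χ q y.1) *
      inner ℝ (s p j y) (s q j y)) (volume.restrict U) :=
    integrable_finsetSum _ fun p _ => integrable_finsetSum _ fun q _ =>
      integrable_finsetSum _ fun j _ => (i2 p q j).restrict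
  rw [← integral_finsetSum _ fun p _ => integrable_finsetSum _ fun j _ => i1 p j,
    ← integral_const_mul]
  simp only [← integral_finsetSum Finset.univ fun q (_ : q ∈ Finset.univ) =>
    integrable_finsetSum Finset.univ fun j (_ : j ∈ Finset.univ) => (i2 _ q j).restrict (s := U)]
  rw [← integral_finsetSum _ fun p _ => integrable_finsetSum _ fun q _ =>
    integrable_finsetSum _ fun j _ => (i2 p q j).restrict, ← integral_sub (j1.const_mul 2) j2]
  refine integral_mono ((j1.const_mul 2).sub j2) (integrable_finsetSum _ fun j _ => i3 j)
    fun y => ?_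
  have hj : ∀ j, 2 * (∑ p, χ p y.1 * inner ℝ (s p j y) (w j y))
      - ∑ p, ∑ q, (χ p y.1 * χ q y.1) * inner ℝ (s p j y) (s q j y) ≤ ‖w j y‖ ^ 2 := by
    intro j
    have h1 := norm_sub_sq_real (w j y) (∑ p, χ p y.1 • s p j y)
    have h2 : inner ℝ (w j y) (∑ p, χ p y.1 • s p j y)
        = ∑ p, χ p y.1 * inner ℝ (s p j y) (w j y) := by
      simp only [inner_sum, real_inner_smul_right, real_inner_comm]
    have h3 : ‖∑ p, χ p y.1 • s p j y‖ ^ 2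
        = ∑ p, ∑ q, (χ p y.1 * χ q y.1) * inner ℝ (s p j y) (s q j y) :=
      norm_sq_sum_smul _ _
    rw [h2, h3] at h1
    nlinarith [sq_nonneg ‖w j y - ∑ p, χ p y.1 • s p j y‖]
  have hsum := Finset.sum_le_sum fun j (_ : j ∈ Finset.univ) => hj j
  rw [Finset.sum_sub_distrib, ← Finset.mul_sum] at hsum
  refine le_trans (le_of_eq ?_) hsum
  simp only
  congr 1
  · rw [Finset.sum_comm]
  · rw [eq_comm, Finset.sum_comm]
    refine Finset.sum_congr rfl fun q _ => ?_
    rw [Finset.sum_comm]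

end Duality

section Scaling

/-- The anisotropic dilation `(y', y₃) ↦ (ε y', y₃)`. -/
def dilation (ε : ℝ) (hε : ε ≠ 0) : Space ≃L[ℝ] Space :=
  (ContinuousLinearEquiv.smulLeft (Units.mk0 ε hε)).prodCongr (ContinuousLinearEquiv.refl ℝ ℝ)

theorem dilation_apply (ε : ℝ) (hε : ε ≠ 0) (y : Space) : dilation ε hε y = (ε • y.1, y.2) := rfl

theorem map_dilation {ε : ℝ} (hε : 0 < ε) :
    Measure.map (fun y : Space => (ε • y.1, y.2)) volume
      = ENNReal.ofReal ((ε ^ 2)⁻¹) • (volume : Measure Space) := by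
  have h := Measure.map_prod_map (volume : Measure Plane) (volume : Measure ℝ)
    (measurable_const_smul ε) measurable_id
  rw [Measure.map_addHaar_smul _ hε.ne', Measure.map_id, Measure.prod_smul_left] at h
  rw [Measure.volume_eq_prod]
  simp only [finrank_euclideanSpace, Fintype.card_fin] at h
  rw [abs_of_pos (by positivity)] at h
  exact h.symm

variable {f₁ f₂ : Plane → ℝ} {ω : Set Plane}

/-- The film in the microscopic variables. -/
abbrev microFilm (ω : Set Plane) (f₁ f₂ : Plane → ℝ) (ε : ℝ) : Set Space :=
  between ((fun x : Plane => ε • x) ⁻¹' ω) f₁ f₂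

theorem preimage_film {ε : ℝ} (hε : 0 < ε) :
    (fun y : Space => (ε • y.1, y.2)) ⁻¹' film ω f₁ f₂ ε = microFilm ω f₁ f₂ ε := by
  ext y
  simp [film, between, smul_smul, hε.ne']

theorem lintegral_film {ε : ℝ} (hε : 0 < ε) (G : Space → ℝ≥0∞) :
    ∫⁻ x in film ω f₁ f₂ ε, G x
      = ENNReal.ofReal (ε ^ 2) * ∫⁻ y in microFilm ω f₁ f₂ ε, G (ε • y.1, y.2) := by
  have hme : MeasurableEmbedding fun y : Space => (ε • y.1, y.2) :=
    (dilation ε hε.ne').toHomeomorph.measurableEmbedding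
  rw [← preimage_film hε, ← hme.lintegral_map, ← hme.restrict_map, map_dilation hε,
    Measure.restrict_smul, lintegral_smul_measure, smul_eq_mul, ← mul_assoc,
    ← ENNReal.ofReal_mul (by positivity), mul_inv_cancel₀ (by positivity), ENNReal.ofReal_one,
    one_mul]

theorem HasWeakDeriv.dilate {ε : ℝ} (hε : 0 < ε) {u w : Space → Vec3} {v v' : Space}
    (hv : v' = (ε • v.1, v.2)) (h : HasWeakDeriv (film ω f₁ f₂ ε) u v' w) :
    HasWeakDeriv (microFilm ω f₁ f₂ ε) (fun y => u (ε • y.1, y.2)) v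
      fun y => w (ε • y.1, y.2) := by
  have h' : HasWeakDeriv (film ω f₁ f₂ ε) u (dilation ε hε.ne' v) w := by
    rw [dilation_apply, ← hv]
    exact h
  have key := HasWeakDeriv.comp_affine (dilation ε hε.ne') 0 (c := ENNReal.ofReal ((ε ^ 2)⁻¹))
    ENNReal.ofReal_ne_top (by simpa [dilation_apply] using map_dilation hε) h'
  simp only [add_zero, dilation_apply] at key
  rwa [preimage_film hε] at key

/-- The gradient in the microscopic variables. -/
def microGrad (ω : Set Plane) (f₁ f₂ : Plane → ℝ) (ε : ℝ) (u : Space → Vec3) (j : Fin 3)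
    (y : Space) : Vec3 :=
  (![ε, ε, 1] j) • weakDeriv (film ω f₁ f₂ ε) u (axis j) (ε • y.1, y.2)

theorem hasGrad_microGrad {ε : ℝ} (hε : 0 < ε) {u : Space → Vec3}
    (hu : MemH1 (film ω f₁ f₂ ε) u) :
    HasGrad (microFilm ω f₁ f₂ ε) (fun y => u (ε • y.1, y.2)) (microGrad ω f₁ f₂ ε u) := by
  intro j
  have h := (hu.hasWeakDeriv (axis j)).smul_dir (![ε, ε, 1] j)
  exact h.dilate hε (by fin_cases j <;> simp [axis])

theorem exchangeEnergy_eq {ε : ℝ} (hε : 0 < ε) (u : Space → Vec3) :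
    exchangeEnergy ω f₁ f₂ ε u = ∫⁻ y in microFilm ω f₁ f₂ ε,
      ENNReal.ofReal (∑ j, ‖microGrad ω f₁ f₂ ε u j y‖ ^ 2) := by
  rw [exchangeEnergy, lintegral_film hε, ← lintegral_const_mul' _ _ ENNReal.ofReal_ne_top]
  refine lintegral_congr fun y => ?_
  rw [← ENNReal.ofReal_mul (by positivity)]
  congr 1
  simp only [microGrad, norm_smul, mul_pow, Fin.sum_univ_three]
  simp only [frobSq, gradPlane, derivVert, EuclideanSpace.real_norm_sq_eq, axis]
  simp [Fin.sum_univ_three]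
  field_simp
  ring

end Scaling

section Pairing

theorem abs_integral_inner_le {α : Type*} {mα : MeasurableSpace α} {μ : Measure α}
    {a b : α → Vec3} (ha : MemLp a 2 μ) (hb : MemLp b 2 μ) {θ : ℝ} (hθ : 0 < θ) :
    |∫ x, inner ℝ (a x) (b x) ∂μ| ≤ θ * ∫ x, ‖a x‖ ^ 2 ∂μ + θ⁻¹ * ∫ x, ‖b x‖ ^ 2 ∂μ := by
  have ia := ha.integrable_norm_pow two_ne_zero
  have ib := hb.integrable_norm_pow two_ne_zero
  rw [← integral_const_mul, ← integral_const_mul,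
    ← integral_add (ia.const_mul _) (ib.const_mul _)]
  refine (abs_integral_le_integral_abs).trans (integral_mono
    (integrable_inner_of_memLp_two ha hb).abs ((ia.const_mul _).add (ib.const_mul _)) fun x => ?_)
  refine (abs_real_inner_le_norm _ _).trans ?_
  have h1 : θ * ‖a x‖ ^ 2 + θ⁻¹ * ‖b x‖ ^ 2 - ‖a x‖ * ‖b x‖
      = θ⁻¹ * ((θ * ‖a x‖ - ‖b x‖ / 2) ^ 2 + 3 / 4 * ‖b x‖ ^ 2) := by
    field_simp
    ring
  have h2 : 0 ≤ θ⁻¹ * ((θ * ‖a x‖ - ‖b x‖ / 2) ^ 2 + 3 / 4 * ‖b x‖ ^ 2) := by positivity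
  simp only
  linarith

theorem tendsto_of_approx {ι : Type*} {l : Filter ι} {a : ι → ℝ} {α : ℝ}
    (h : ∀ τ > 0, ∃ (b : ι → ℝ) (β : ℝ), Tendsto b l (𝓝 β) ∧ |α - β| ≤ τ ∧
      ∀ᶠ i in l, |a i - b i| ≤ τ) : Tendsto a l (𝓝 α) := by
  rw [Metric.tendsto_nhds]
  intro τ hτ
  obtain ⟨b, β, hb, hαβ, hab⟩ := h (τ / 4) (by positivity)
  filter_upwards [hab, Metric.tendsto_nhds.1 hb (τ / 4) (by positivity)] with i h1 h2
  rw [Real.dist_eq, abs_lt] at *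
  rw [abs_le] at *
  constructor <;> linarith [h1.1, h1.2, h2.1, h2.2, hαβ.1, hαβ.2]

/-- Vector-valued version of the weak convergence of oscillating periodic functions. -/
theorem tendsto_oscillating_inner {F : Plane → Vec3} (hF : Continuous F)
    (hc : HasCompactSupport F) {s : Space → Vec3} (hm : Measurable s) (hp : LatticePeriodic s)
    (hs : IntegrableOn s column) :
    Tendsto (fun ε : ℝ => ε ^ 2 * ∫ y : Space, inner ℝ (s y) (F (ε • y.1))) (𝓝[>] 0)
      (𝓝 (∫ x, inner ℝ (F x) (∫ y in column, s y))) := by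
  have hFi : ∀ i, Continuous fun x => F x i := fun i => by fun_prop
  have hFc : ∀ i, HasCompactSupport fun x => F x i := fun i =>
    hc.comp_left (g := fun v : Vec3 => v i) rfl
  have hsm : ∀ i, Measurable fun y => s y i := fun i => by fun_prop
  have hsp : ∀ i, LatticePeriodic fun y => s y i := fun i => hp.comp fun v : Vec3 => v i
  have hsi : ∀ i, IntegrableOn (fun y => s y i) column := fun i =>
    (EuclideanSpace.proj (𝕜 := ℝ) i).integrable_comp hs
  have hS : ∀ i, (∫ y in column, s y) i = ∫ y in column, s y i := fun i =>
    ((EuclideanSpace.proj (𝕜 := ℝ) i).integral_comp_comm hs).symm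
  have key := tendsto_finsetSum Finset.univ fun i (_ : i ∈ Finset.univ) =>
    tendsto_oscillating (hFi i) (hFc i) (hsm i) (hsp i) (hsi i)
  have e1 : ∫ x, inner ℝ (F x) (∫ y in column, s y)
      = ∑ i, (∫ x, F x i) * ∫ y in column, s y i := by
    simp only [PiLp.inner_apply, hS]
    rw [integral_finsetSum]
    · refine Finset.sum_congr rfl fun i _ => ?_
      rw [← integral_mul_const]
      refine integral_congr_ae (Eventually.of_forall fun x => ?_)
      simp [mul_comm]
    · intro i _
      simpa [mul_comm] using ((hFi i).integrable_of_hasCompactSupport (hFc i)).mul_const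
        (∫ y in column, s y i)
  rw [e1]
  refine key.congr' ?_
  filter_upwards [self_mem_nhdsWithin] with ε hε
  rw [← Finset.mul_sum, ← integral_finsetSum]
  · congr 1
  · intro i _
    have hε' : ε ≠ 0 := ne_of_gt hε
    exact integrable_mul_periodic (F := fun x => F (ε • x) i) (by fun_prop)
      ((hFc i).comp_smul hε') (hsm i) (hsp i) (hsi i)

variable {f₁ f₂ : Plane → ℝ} {ω : Set Plane}

theorem film_subset (hp : ∀ x, 0 < f₁ x) {M : ℝ} (hM : ∀ x, f₂ x ≤ M) (ε : ℝ) :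
    film ω f₁ f₂ ε ⊆ ω ×ˢ Set.Icc 0 M :=
  fun _ hy => ⟨hy.1, (hp _).le.trans hy.2.1.le, hy.2.2.le.trans (hM _)⟩

theorem enorm_sub_sq_le (a b c : Vec3) :
    ‖a - c‖ₑ ^ 2 ≤ 2 * ‖a - b‖ₑ ^ 2 + 2 * ‖b - c‖ₑ ^ 2 := by
  have h : ‖a - c‖ ^ 2 ≤ 2 * ‖a - b‖ ^ 2 + 2 * ‖b - c‖ ^ 2 := by
    have h1 := norm_sub_le_norm_sub_add_norm_sub a b c
    nlinarith [sq_nonneg (‖a - b‖ - ‖b - c‖), norm_nonneg (a - c), norm_nonneg (a - b),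
      norm_nonneg (b - c)]
  have h2 := ENNReal.ofReal_le_ofReal h
  rw [ENNReal.ofReal_add (by positivity) (by positivity), ENNReal.ofReal_mul (by norm_num),
    ENNReal.ofReal_mul (by norm_num)] at h2
  simpa [ENNReal.ofReal_pow, ofReal_norm] using h2

theorem lintegral_film_fst_le (hp : ∀ x, 0 < f₁ x) {M : ℝ} (hM : ∀ x, f₂ x ≤ M) (ε : ℝ)
    {F : Plane → ℝ≥0∞} (hF : AEMeasurable F (volume.restrict ω)) :
    ∫⁻ x in film ω f₁ f₂ ε, F x.1 ≤ ENNReal.ofReal M * ∫⁻ x in ω, F x := by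
  refine (lintegral_mono_set (film_subset hp hM ε)).trans_eq ?_
  rw [Measure.volume_eq_prod, ← Measure.prod_restrict, lintegral_prod _ hF.comp_fst]
  simp [lintegral_mul_const'', hF, mul_comm]

theorem eLpNorm_two_sq {α : Type*} {mα : MeasurableSpace α} {μ : Measure α} (u : α → Vec3) :
    eLpNorm u 2 μ ^ 2 = ∫⁻ x, ‖u x‖ₑ ^ 2 ∂μ := by
  have := eLpNorm_nnreal_pow_eq_lintegral (f := u) (μ := μ) (p := 2) two_ne_zero
  simpa using this

theorem exists_continuous_approx
    (hp : ∀ x, 0 < f₁ x) {M : ℝ} (hM0 : 0 ≤ M) (hM : ∀ x, f₂ x ≤ M)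
    {m₀ : Plane → Vec3} (hm₀ : MemLp m₀ 2 (volume.restrict ω)) {m : ℝ → Space → Vec3}
    (hconv : Tendsto (fun ε : ℝ => ∫⁻ x in film ω f₁ f₂ ε, ‖m ε x - m₀ x.1‖ₑ ^ 2)
      (𝓝[>] 0) (𝓝 0)) {κ : ℝ} (hκ : 0 < κ) :
    ∃ g : Plane → Vec3, Continuous g ∧ HasCompactSupport g ∧
      ∫⁻ x in ω, ‖m₀ x - g x‖ₑ ^ 2 ≤ ENNReal.ofReal κ ∧
      ∀ᶠ ε in 𝓝[>] 0, ∫⁻ x in film ω f₁ f₂ ε, ‖m ε x - g x.1‖ₑ ^ 2 ≤ ENNReal.ofReal κ := by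
  set e : ℝ := √(κ / (4 * (M + 1))) with he
  have he0 : 0 < e := Real.sqrt_pos.2 (by positivity)
  have he2 : e ^ 2 = κ / (4 * (M + 1)) := Real.sq_sqrt (by positivity)
  obtain ⟨g, hgc, hg, hgcont, hgm⟩ := MemLp.exists_hasCompactSupport_eLpNorm_sub_le
    (μ := (volume : Measure Plane).restrict ω) (by simp) hm₀
    (ε := ENNReal.ofReal e) (by simpa using he0)
  have hgsq : ∫⁻ x in ω, ‖m₀ x - g x‖ₑ ^ 2 ≤ ENNReal.ofReal (e ^ 2) := by
    have := pow_le_pow_left₀ (zero_le) hg 2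
    rw [eLpNorm_two_sq, ← ENNReal.ofReal_pow he0.le] at this
    exact this
  refine ⟨g, hgcont, hgc, hgsq.trans (ENNReal.ofReal_le_ofReal ?_), ?_⟩
  · rw [he2]
    exact div_le_self hκ.le (by linarith)
  · have hev : ∀ᶠ ε in 𝓝[>] (0 : ℝ), ∫⁻ x in film ω f₁ f₂ ε, ‖m ε x - m₀ x.1‖ₑ ^ 2
        < ENNReal.ofReal (κ / 4) :=
      hconv.eventually (gt_mem_nhds (by simpa using hκ))
    filter_upwards [hev] with ε hε
    have hF : AEMeasurable (fun x => ‖m₀ x - g x‖ₑ ^ 2) (volume.restrict ω) :=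
      (hm₀.1.sub hgm.1).enorm.pow_const 2
    have hF' : AEMeasurable (fun x : Space => 2 * ‖m₀ x.1 - g x.1‖ₑ ^ 2)
        (volume.restrict (film ω f₁ f₂ ε)) := by
      have h1 : AEMeasurable (fun x : Space => 2 * ‖m₀ x.1 - g x.1‖ₑ ^ 2)
          ((volume.restrict ω).prod (volume.restrict (Set.Icc 0 M))) :=
        (hF.const_mul 2).comp_fst
      rw [Measure.prod_restrict] at h1
      exact h1.mono_measure (Measure.restrict_mono (film_subset hp hM ε) le_rfl)
    calc ∫⁻ x in film ω f₁ f₂ ε, ‖m ε x - g x.1‖ₑ ^ 2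
        ≤ ∫⁻ x in film ω f₁ f₂ ε, (2 * ‖m ε x - m₀ x.1‖ₑ ^ 2 + 2 * ‖m₀ x.1 - g x.1‖ₑ ^ 2) :=
          lintegral_mono fun x => enorm_sub_sq_le _ _ _
      _ ≤ 2 * ENNReal.ofReal (κ / 4) + 2 * (ENNReal.ofReal M * ENNReal.ofReal (e ^ 2)) := by
          rw [lintegral_add_right' _ hF', lintegral_const_mul' _ _ (by simp),
            lintegral_const_mul' _ _ (by simp)]
          gcongr
          exact (lintegral_film_fst_le hp hM ε hF).trans (by gcongr)
      _ ≤ ENNReal.ofReal κ := by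
          rw [← ENNReal.ofReal_mul hM0, show (2 : ℝ≥0∞) = ENNReal.ofReal 2 by simp,
            ← ENNReal.ofReal_mul (by norm_num), ← ENNReal.ofReal_mul (by norm_num),
            ← ENNReal.ofReal_add (by positivity) (by positivity)]
          refine ENNReal.ofReal_le_ofReal ?_
          rw [he2]
          have : M * (κ / (4 * (M + 1))) ≤ κ / 4 := by
            rw [← mul_div_assoc, div_le_div_iff₀ (by positivity) (by norm_num)]
            nlinarith
          linarith

end Pairing

section Density

/-- Smooth compactly supported functions are dense in `L²(ω)`. -/
theorem exists_test_approx {ω : Set Plane} (hω : IsOpen ω) {u : Plane → ℝ}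
    (hu : MemLp u 2 (volume.restrict ω)) {δ : ℝ} (hδ : 0 < δ) :
    ∃ ψ : Plane → ℝ, ContDiff ℝ (⊤ : ℕ∞) ψ ∧ HasCompactSupport ψ ∧ tsupport ψ ⊆ ω ∧
      ∫ x in ω, (u x - ψ x) ^ 2 ≤ δ := by
  let K : Submodule ℝ (Lp ℝ 2 ((volume : Measure Plane).restrict ω)) :=
    { carrier := {f | ∃ ψ : Plane → ℝ, ContDiff ℝ (⊤ : ℕ∞) ψ ∧ HasCompactSupport ψ ∧
        tsupport ψ ⊆ ω ∧ f =ᵐ[volume.restrict ω] ψ}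
      add_mem' := by
        rintro f g ⟨φ, h1, h2, h3, h4⟩ ⟨ψ, k1, k2, k3, k4⟩
        exact ⟨φ + ψ, h1.add k1, h2.add k2, (tsupport_add φ ψ).trans (Set.union_subset h3 k3),
          (Lp.coeFn_add f g).trans (h4.add k4)⟩
      zero_mem' := ⟨0, contDiff_const, HasCompactSupport.zero, by simp, Lp.coeFn_zero _ _ _⟩
      smul_mem' := by
        rintro c f ⟨φ, h1, h2, h3, h4⟩
        exact ⟨c • φ, h1.const_smul c, h2.smul_left,
          (tsupport_smul_subset_right (fun _ => c) φ).trans h3,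
          (Lp.coeFn_smul c f).trans (h4.const_smul c)⟩ }
  have hK : K.topologicalClosure = ⊤ := by
    rw [Submodule.topologicalClosure_eq_top_iff, Submodule.eq_bot_iff]
    intro f hf
    have hloc : LocallyIntegrableOn f ω volume :=
      locallyIntegrableOn_of_locallyIntegrable_restrict ((Lp.memLp f).locallyIntegrable one_le_two)
    have h0 := hω.ae_eq_zero_of_integral_contDiff_smul_eq_zero hloc fun ψ h1 h2 h3 => by
      have hψ : MemLp ψ 2 (volume.restrict ω) :=
        (h1.continuous.memLp_of_hasCompactSupport h2).restrict ω
      have hmem : hψ.toLp ψ ∈ K := ⟨ψ, h1, h2, h3, hψ.coeFn_toLp⟩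
      have hin := (Submodule.mem_orthogonal _ _).1 hf _ hmem
      rw [L2.inner_def] at hin
      rw [← setIntegral_eq_integral_of_forall_compl_eq_zero (s := ω), ← hin]
      · refine integral_congr_ae ?_
        filter_upwards [hψ.coeFn_toLp] with x hx
        rw [hx]
        simp [mul_comm]
      · intro x hx
        rw [eq_zero_of_notMem h3 hx, zero_smul]
    refine Lp.ext ?_
    filter_upwards [(ae_restrict_iff' hω.measurableSet).2 h0, Lp.coeFn_zero ℝ 2
      ((volume : Measure Plane).restrict ω)] with x h1 h2
    rw [h1, h2]
    rfl
  have hmem : hu.toLp u ∈ K.topologicalClosure := by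
    rw [hK]
    trivial
  obtain ⟨f, ⟨ψ, h1, h2, h3, h4⟩, hd⟩ := Metric.mem_closure_iff.1 hmem (√δ) (Real.sqrt_pos.2 hδ)
  refine ⟨ψ, h1, h2, h3, ?_⟩
  have hn : ‖hu.toLp u - f‖ ^ 2 = ∫ x in ω, (u x - ψ x) ^ 2 := by
    rw [← real_inner_self_eq_norm_sq, L2.inner_def]
    refine integral_congr_ae ?_
    filter_upwards [hu.coeFn_toLp, h4, Lp.coeFn_sub (hu.toLp u) f] with x e1 e2 e3
    rw [e3, Pi.sub_apply, e1, e2]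
    simp [sq]
  rw [← hn, ← Real.sq_sqrt hδ.le]
  rw [dist_eq_norm] at hd
  exact pow_le_pow_left₀ (norm_nonneg _) hd.le 2

end Density

section Limit

variable {f₁ f₂ : Plane → ℝ} {ω : Set Plane}

theorem isBounded_preimage_smul (hω : Bornology.IsBounded ω) {ε : ℝ} (hε : 0 < ε) :
    Bornology.IsBounded ((fun x : Plane => ε • x) ⁻¹' ω) := by
  obtain ⟨R, hR⟩ := hω.exists_norm_le
  refine (Metric.isBounded_closedBall (x := (0 : Plane)) (r := R / ε)).subset fun x hx => ?_
  have := hR _ hx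
  rw [norm_smul, Real.norm_eq_abs, abs_of_pos hε] at this
  rwa [mem_closedBall_zero_iff, le_div_iff₀ hε, mul_comm]

/-- Passage to the limit in the pairing of a strongly convergent sequence with an oscillating
periodic field. -/
theorem tendsto_pairing (hp : ∀ x, 0 < f₁ x) {M : ℝ} (hM0 : 0 ≤ M) (hM : ∀ x, f₂ x ≤ M)
    (hωb : Bornology.IsBounded ω)
    {m₀ : Plane → Vec3} (hm₀ : MemLp m₀ 2 (volume.restrict ω)) {m : ℝ → Space → Vec3}
    (hm : ∀ ε : ℝ, 0 < ε →
      MemLp (fun y : Space => m ε (ε • y.1, y.2)) 2 (volume.restrict (microFilm ω f₁ f₂ ε)))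
    (hconv : Tendsto (fun ε : ℝ => ∫⁻ x in film ω f₁ f₂ ε, ‖m ε x - m₀ x.1‖ₑ ^ 2)
      (𝓝[>] 0) (𝓝 0)) {s : Space → Vec3} (hsm : Measurable s) (hsp : LatticePeriodic s)
    (hs : MemLp s 2 (volume.restrict column)) (hs0 : ∀ y ∉ strip f₁ f₂, s y = 0)
    (hsi : IntegrableOn s column)
    {η : Plane → ℝ} (hη : Continuous η) (hηc : HasCompactSupport η) (hηs : tsupport η ⊆ ω) :
    Tendsto (fun ε : ℝ => ε ^ 2 * ∫ y in microFilm ω f₁ f₂ ε,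
        η (ε • y.1) * inner ℝ (s y) (m ε (ε • y.1, y.2))) (𝓝[>] 0)
      (𝓝 (∫ x in ω, η x * inner ℝ (m₀ x) (∫ y in column, s y))) := by
  set S := ∫ y in column, s y with hS
  set Λ : ℝ := (∫ x, η x ^ 2) * ∫ y in column, ‖s y‖ ^ 2 with hΛ
  set Λ' : ℝ := ∫ x in ω, ‖η x • S‖ ^ 2 with hΛ'
  have hΛ0 : 0 ≤ Λ := mul_nonneg (integral_nonneg fun _ => sq_nonneg _)
    (integral_nonneg fun _ => by positivity)
  have hΛ'0 : 0 ≤ Λ' := integral_nonneg fun _ => by positivity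
  have hosc : Tendsto (fun ε : ℝ => ε ^ 2 * ∫ y : Space, η (ε • y.1) ^ 2 * ‖s y‖ ^ 2) (𝓝[>] 0)
      (𝓝 Λ) :=
    tendsto_oscillating (F := fun x => η x ^ 2) (by fun_prop)
      (hηc.comp_left (g := fun t : ℝ => t ^ 2) (by simp)) (by fun_prop)
      (hsp.comp fun v => ‖v‖ ^ 2) (hs.integrable_norm_pow two_ne_zero)
  refine tendsto_of_approx fun τ hτ => ?_
  set θ : ℝ := τ / (2 * (Λ + Λ' + 1)) with hθ
  have hθ0 : 0 < θ := by positivity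
  obtain ⟨g, hg, hgc, hgω, hgε⟩ := exists_continuous_approx hp hM0 hM hm₀ hconv
    (κ := θ * (τ / 2)) (by positivity)
  have hF : Continuous fun x => η x • g x := by fun_prop
  have hFc : HasCompactSupport fun x => η x • g x := hηc.smul_right
  have hgm : ∀ {μ : Measure Plane} [IsFiniteMeasureOnCompacts μ], MemLp g 2 μ := fun {μ} _ =>
    hg.memLp_of_hasCompactSupport hgc
  have hsplit : ∀ {A X Y : ℝ}, A ≤ Λ + Λ' + 1 → 0 ≤ Y → Y ≤ θ * (τ / 2) → X ≤ θ * A + θ⁻¹ * Y →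
      X ≤ τ := by
    intro A X Y hA _ hY hX
    have h1 : θ * A ≤ τ / 2 := by
      calc θ * A ≤ θ * (Λ + Λ' + 1) := by gcongr
        _ = τ / 2 := by
          rw [hθ]
          field_simp
    have h2 : θ⁻¹ * Y ≤ τ / 2 := by
      rw [inv_mul_le_iff₀ hθ0]
      exact hY
    linarith
  refine ⟨_, _, tendsto_oscillating_inner hF hFc hsm hsp hsi, ?_, ?_⟩
  · have hηS : MemLp (fun x => η x • S) 2 (volume.restrict ω) :=
      ((hη.smul continuous_const).memLp_of_hasCompactSupport hηc.smul_right).restrict ω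
    have hb : MemLp (fun x => m₀ x - g x) 2 (volume.restrict ω) := hm₀.sub hgm
    have e : ∫ x, inner ℝ (η x • g x) S = ∫ x in ω, inner ℝ (η x • S) (g x) := by
      rw [← setIntegral_eq_integral_of_forall_compl_eq_zero (s := ω)]
      · refine integral_congr_ae (Eventually.of_forall fun x => ?_)
        simp only
        rw [real_inner_smul_left, real_inner_smul_left, real_inner_comm]
      · intro x hx
        rw [eq_zero_of_notMem hηs hx, zero_smul, inner_zero_left]
    have e' : ∫ x in ω, η x * inner ℝ (m₀ x) S = ∫ x in ω, inner ℝ (η x • S) (m₀ x) := by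
      refine integral_congr_ae (Eventually.of_forall fun x => ?_)
      simp only
      rw [real_inner_smul_left, real_inner_comm]
    rw [e, e', ← integral_sub (integrable_inner_of_memLp_two hηS hm₀)
      (integrable_inner_of_memLp_two hηS hgm)]
    simp only [← inner_sub_right]
    refine hsplit (A := Λ') (Y := ∫ x in ω, ‖m₀ x - g x‖ ^ 2) (by linarith)
      (integral_nonneg fun _ => by positivity) ?_ (abs_integral_inner_le hηS hb hθ0)
    refine (ENNReal.ofReal_le_ofReal_iff (by positivity)).1 (le_trans (le_of_eq ?_) hgω)
    rw [ofReal_integral_eq_lintegral_ofReal (hb.integrable_norm_pow two_ne_zero)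
      (Eventually.of_forall fun _ => by positivity)]
    simp [ENNReal.ofReal_pow, ofReal_norm]
  · filter_upwards [hgε, hosc.eventually (gt_mem_nhds (lt_add_one Λ)), self_mem_nhdsWithin]
      with ε h1 h2 hε
    have hε : 0 < ε := hε
    have hηε : Continuous fun x : Plane => η (ε • x) := by fun_prop
    have hηεc : HasCompactSupport fun x : Plane => η (ε • x) := hηc.comp_smul hε.ne'
    set U := microFilm ω f₁ f₂ ε with hU
    have hUfin : IsFiniteMeasure ((volume : Measure Space).restrict U) :=
      ⟨by simpa using volume_between_lt_top (isBounded_preimage_smul hωb hε) hp hM⟩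
    have ha' : MemLp (fun y : Space => η (ε • y.1) • s y) 2 volume :=
      memLp_weight hsm hsp hs hηε hηεc
    have ha := ha'.restrict U
    obtain ⟨C, hC⟩ := hg.bounded_above_of_compact_support hgc
    have hgU : MemLp (fun y : Space => g (ε • y.1)) 2 (volume.restrict U) :=
      MemLp.of_bound (by fun_prop : Continuous _).aestronglyMeasurable C
        (Eventually.of_forall fun y => hC _)
    have hb := (hm ε hε).sub hgU
    have e : ∫ y : Space, inner ℝ (s y) (η (ε • y.1) • g (ε • y.1))
        = ∫ y in U, inner ℝ (η (ε • y.1) • s y) (g (ε • y.1)) := by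
      rw [← setIntegral_eq_integral_of_forall_compl_eq_zero (s := U)]
      · simp only [real_inner_smul_left, real_inner_smul_right]
      · intro y hy
        by_cases hyO : ε • y.1 ∈ ω
        · rw [hs0 y fun hyS => hy ⟨hyO, hyS.2⟩, inner_zero_left]
        · rw [eq_zero_of_notMem hηs hyO, zero_smul, inner_zero_right]
    have e' : ∫ y in U, η (ε • y.1) * inner ℝ (s y) (m ε (ε • y.1, y.2))
        = ∫ y in U, inner ℝ (η (ε • y.1) • s y) (m ε (ε • y.1, y.2)) := by
      simp only [real_inner_smul_left]
    rw [e, e', ← mul_sub, ← integral_sub (integrable_inner_of_memLp_two ha (hm ε hε))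
      (integrable_inner_of_memLp_two ha hgU), abs_mul, abs_of_pos (by positivity : 0 < ε ^ 2)]
    simp only [← inner_sub_right]
    have hle := mul_le_mul_of_nonneg_left (abs_integral_inner_le ha hb hθ0)
      (by positivity : 0 ≤ ε ^ 2)
    rw [mul_add, mul_left_comm, mul_left_comm (ε ^ 2)] at hle
    refine hsplit ?_ (by positivity) ?_ hle
    · have h3 : ∫ y in U, ‖η (ε • y.1) • s y‖ ^ 2
          ≤ ∫ y : Space, η (ε • y.1) ^ 2 * ‖s y‖ ^ 2 := by
        refine (setIntegral_le_integral (ha'.integrable_norm_pow two_ne_zero)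
          (Eventually.of_forall fun _ => by positivity)).trans_eq ?_
        simp only [norm_smul, mul_pow, Real.norm_eq_abs, sq_abs]
      have h4 := mul_le_mul_of_nonneg_left h3 (by positivity : 0 ≤ ε ^ 2)
      linarith
    · refine (ENNReal.ofReal_le_ofReal_iff (by positivity)).1 (le_trans (le_of_eq ?_) h1)
      rw [lintegral_film hε, ENNReal.ofReal_mul (by positivity),
        ofReal_integral_eq_lintegral_ofReal (hb.integrable_norm_pow two_ne_zero)
        (Eventually.of_forall fun _ => by positivity)]
      simp [ENNReal.ofReal_pow, ofReal_norm]

end Limit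

section LowerBound

variable {f₁ f₂ : Plane → ℝ} {ω : Set Plane}

theorem fderiv_smul_comp_smul {Ψ : Plane → ℝ} (hΨ : ContDiff ℝ (⊤ : ℕ∞) Ψ) (ε : ℝ) (x v : Plane) :
    fderiv ℝ (fun x => ε * Ψ (ε • x)) x v = ε ^ 2 * fderiv ℝ Ψ (ε • x) v := by
  have h1 : HasFDerivAt Ψ (fderiv ℝ Ψ (ε • x)) (ε • x) :=
    (hΨ.differentiable (by simp) _).hasFDerivAt
  have h2 := (h1.comp x ((hasFDerivAt_id (𝕜 := ℝ) x).const_smul ε)).const_mul ε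
  refine (congrArg (fun L : Plane →L[ℝ] ℝ => L v) h2.fderiv).trans ?_
  simp
  ring

/-- The dual lower bound for the exchange energy, for a fixed choice of test functions. -/
theorem ofReal_le_exchangeEnergy {P : Type*} [Fintype P] (hc₁ : Continuous f₁)
    (hc₂ : Continuous f₂) (hω : IsOpen ω) {s : P → Fin 3 → Space → Vec3}
    (hs : ∀ p, IsDualField f₁ f₂ (s p)) {ε : ℝ} (hε : 0 < ε) {u : Space → Vec3}
    (hu : MemH1 (film ω f₁ f₂ ε) u) {Ψ : P → Plane → ℝ} (hΨ : ∀ p, ContDiff ℝ (⊤ : ℕ∞) (Ψ p))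
    (hc : ∀ p, HasCompactSupport (Ψ p)) (hΨs : ∀ p, tsupport (Ψ p) ⊆ ω) :
    ENNReal.ofReal (-2 * (∑ p, ∑ j, ε ^ 2 * ∫ y in microFilm ω f₁ f₂ ε,
        fderiv ℝ (Ψ p) (ε • y.1) (axis j).1 * inner ℝ (s p j y) (u (ε • y.1, y.2)))
      - ∑ p, ∑ q, ε ^ 2 * ∫ y : Space, (Ψ p (ε • y.1) * Ψ q (ε • y.1))
          * ∑ j, inner ℝ (s p j y) (s q j y)) ≤ exchangeEnergy ω f₁ f₂ ε u := by
  have hG := hasGrad_microGrad hε hu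
  have hO : IsOpen ((fun x : Plane => ε • x) ⁻¹' ω) := hω.preimage (continuous_const_smul ε)
  have hts : ∀ p, tsupport (fun x => ε * Ψ p (ε • x)) ⊆ (fun x : Plane => ε • x) ⁻¹' ω := by
    intro p
    refine (tsupport_mul_subset_right (f := fun _ => ε)).trans ?_
    exact (tsupport_comp_subset_preimage (Ψ p) (continuous_const_smul ε)).trans
      (Set.preimage_mono (hΨs p))
  have key := energy_lower_bound hc₁ hc₂ hs hO hG (χ := fun p x => ε * Ψ p (ε • x))
    (fun p => contDiff_const.mul ((hΨ p).comp (contDiff_const_smul ε)))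
    (fun p => ((hc p).comp_smul hε.ne').mul_left) hts
  rw [exchangeEnergy_eq hε, ← ofReal_integral_eq_lintegral_ofReal
    (integrable_finsetSum _ fun j _ => (hG j).2.1.integrable_norm_pow two_ne_zero)
    (Eventually.of_forall fun y => by positivity)]
  refine ENNReal.ofReal_le_ofReal (le_trans (le_of_eq ?_) key)
  simp only [fderiv_smul_comp_smul (hΨ _), ← integral_const_mul]
  congr 1
  · simp only [mul_assoc]
  · refine Finset.sum_congr rfl fun p _ => Finset.sum_congr rfl fun q _ => ?_
    refine integral_congr_ae (Eventually.of_forall fun y => ?_)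
    simp only
    ring

/-- Passage to the limit in the dual lower bound. -/
theorem ofReal_le_liminf {P : Type*} [Fintype P] (hc₁ : Continuous f₁) (hc₂ : Continuous f₂)
    (hp : ∀ x, 0 < f₁ x) {M : ℝ} (hM0 : 0 ≤ M) (hM : ∀ x, f₂ x ≤ M) (hω : IsOpen ω)
    (hωb : Bornology.IsBounded ω) {m₀ : Plane → Vec3} (hm₀ : MemLp m₀ 2 (volume.restrict ω))
    {m : ℝ → Space → Vec3} (hm : ∀ ε : ℝ, 0 < ε → MemH1 (film ω f₁ f₂ ε) (m ε))
    (hconv : Tendsto (fun ε : ℝ => ∫⁻ x in film ω f₁ f₂ ε, ‖m ε x - m₀ x.1‖ₑ ^ 2)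
      (𝓝[>] 0) (𝓝 0)) {s : P → Fin 3 → Space → Vec3} (hs : ∀ p, IsDualField f₁ f₂ (s p))
    (hsi : ∀ p j, IntegrableOn (s p j) column)
    {Ψ : P → Plane → ℝ} (hΨ : ∀ p, ContDiff ℝ (⊤ : ℕ∞) (Ψ p))
    (hc : ∀ p, HasCompactSupport (Ψ p)) (hΨs : ∀ p, tsupport (Ψ p) ⊆ ω) :
    ENNReal.ofReal (-2 * (∑ p, ∑ j, ∫ x in ω, fderiv ℝ (Ψ p) x (axis j).1 *
        inner ℝ (m₀ x) (∫ y in column, s p j y))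
      - ∑ p, ∑ q, (∫ x, Ψ p x * Ψ q x) * ∫ y in column, ∑ j, inner ℝ (s p j y) (s q j y))
      ≤ liminf (fun ε : ℝ => exchangeEnergy ω f₁ f₂ ε (m ε)) (𝓝[>] 0) := by
  have hmm : ∀ ε : ℝ, 0 < ε →
      MemLp (fun y : Space => m ε (ε • y.1, y.2)) 2 (volume.restrict (microFilm ω f₁ f₂ ε)) :=
    fun ε hε => (hasGrad_microGrad hε (hm ε hε) 0).1
  have t1 := fun p j => tendsto_pairing hp hM0 hM hωb hm₀ hmm hconv ((hs p).measurable j)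
    ((hs p).periodic j) ((hs p).memLp j) ((hs p).eq_zero j) (hsi p j)
    (continuous_fderiv_apply (hΨ p) (axis j).1) (hasCompactSupport_fderiv_apply' (hc p) (axis j).1)
    ((tsupport_fderiv_apply_subset ℝ (axis j).1).trans (hΨs p))
  have t2 := fun p q => tendsto_oscillating (F := fun x => Ψ p x * Ψ q x)
    ((hΨ p).continuous.mul (hΨ q).continuous) (hc p).mul_right
    (h := fun y => ∑ j, inner ℝ (s p j y) (s q j y))
    (Finset.measurable_sum _ fun j _ => ((hs p).measurable j).inner ((hs q).measurable j))
    (fun g hg y => by simp only [(hs p).periodic _ g hg y, (hs q).periodic _ g hg y])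
    (integrable_finsetSum _ fun j _ =>
      integrable_inner_of_memLp_two ((hs p).memLp j) ((hs q).memLp j))
  have T := ((tendsto_finsetSum Finset.univ fun p _ => tendsto_finsetSum Finset.univ fun j _ =>
    t1 p j).const_mul (-2)).sub (tendsto_finsetSum Finset.univ fun p _ =>
      tendsto_finsetSum Finset.univ fun q _ => t2 p q)
  rw [← (ENNReal.tendsto_ofReal T).liminf_eq]
  refine liminf_le_liminf ?_
  filter_upwards [self_mem_nhdsWithin] with ε hε
  exact ofReal_le_exchangeEnergy hc₁ hc₂ hω hs hε (hm ε hε) hΨ hc hΨs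

theorem memLp_coord {α : Type*} {mα : MeasurableSpace α} {μ : Measure α} {w : α → Vec3}
    (hw : MemLp w 2 μ) (i : Fin 3) : MemLp (fun x => w x i) 2 μ :=
  hw.of_le ((by fun_prop : Measurable fun v : Vec3 => v i).comp_aemeasurable
    hw.1.aemeasurable).aestronglyMeasurable
    (Eventually.of_forall fun x => PiLp.norm_apply_le (w x) i)

theorem integral_fderiv_inner {m₀ : Plane → Vec3} (hm₀ : MemH1 ω m₀) {ψ : Plane → ℝ}
    (hψ : ContDiff ℝ (⊤ : ℕ∞) ψ) (hc : HasCompactSupport ψ) (hs : tsupport ψ ⊆ ω) (j : Fin 3)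
    (S : Vec3) :
    ∫ x in ω, fderiv ℝ ψ x (axis j).1 * inner ℝ (m₀ x) S
      = -∫ x in ω, ψ x * inner ℝ (columns (grad₂ ω m₀ x) j) S := by
  have key : ∀ (d : Plane) (w : Plane → Vec3), HasWeakDeriv ω m₀ d w →
      ∫ x in ω, fderiv ℝ ψ x d * inner ℝ (m₀ x) S = -∫ x in ω, ψ x * inner ℝ (w x) S := by
    intro d w hw
    have h := congrArg (fun v => inner ℝ S v) (hw.2.2 ψ hψ hc hs)
    simp only [inner_neg_right] at h
    rw [← integral_inner (integrable_fderiv_smul hψ hc d hw.1),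
      ← integral_inner (integrable_test_smul hψ.continuous hc hw.2.1)] at h
    simpa only [real_inner_smul_right, real_inner_comm S] using h
  fin_cases j
  · exact key _ _ (hm₀.hasWeakDeriv (EuclideanSpace.single 0 1))
  · exact key _ _ (hm₀.hasWeakDeriv (EuclideanSpace.single 1 1))
  · simp [axis, columns]

end LowerBound

end ThinFilm

end

theorem proposition3p14
    (f₁ f₂ : Plane → ℝ)
    (hf₁_pos : ∀ x, 0 < f₁ x) (hf₂_pos : ∀ x, 0 < f₂ x)
    (hf₁_lip : ∃ K : ℝ≥0, LipschitzWith K f₁) (hf₂_lip : ∃ K : ℝ≥0, LipschitzWith K f₂)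
    (hf₁_per : IsPeriodic f₁) (hf₂_per : IsPeriodic f₂)
    (hf : ∀ x, f₁ x < f₂ x)
    (ω : Set Plane) (hω_open : IsOpen ω) (hω_bdd : Bornology.IsBounded ω)
    (hω_lip : HasLipschitzBoundary ω)
    (m₀ : Plane → Vec3) (hm₀ : MemH1Sphere ω m₀)
    (m : ℝ → Space → Vec3) (hm : ∀ ε : ℝ, 0 < ε → MemH1Sphere (film ω f₁ f₂ ε) (m ε))
    (hconv : Tendsto (fun ε : ℝ => ∫⁻ x in film ω f₁ f₂ ε, ‖m ε x - m₀ x.1‖ₑ ^ 2)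
      (𝓝[>] 0) (𝓝 0)) :
    ∫⁻ x in ω, ENNReal.ofReal (gHom f₁ f₂ (grad₂ ω m₀ x))
      ≤ liminf (fun ε : ℝ => exchangeEnergy ω f₁ f₂ ε (m ε)) (𝓝[>] 0) := by
  have hc₁ : Continuous f₁ := hf₁_lip.choose_spec.continuous
  have hc₂ : Continuous f₂ := hf₂_lip.choose_spec.continuous
  obtain ⟨M, hM⟩ := hf₂_per.exists_bound hc₂
  have hM0 : 0 ≤ M := (hf₂_pos 0).le.trans (hM 0)
  have hfin : IsFiniteMeasure ((volume : Measure Space).restrict (cell f₁ f₂)) :=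
    ⟨by simpa [cell] using volume_between_lt_top isBounded_unitSquare hf₁_pos hM⟩
  let a : Fin 3 × Fin 2 → CellFields f₁ f₂ := fun p => flux f₁ f₂ (Matrix.single p.1 p.2 1)
  let s : Fin 3 × Fin 2 → Fin 3 → Space → Vec3 := fun p => extend f₁ f₂ (a p)
  let ζ : Fin 3 × Fin 2 → Plane → ℝ := fun p x => grad₂ ω m₀ x p.1 p.2
  have hs : ∀ p, IsDualField f₁ f₂ (s p) := fun p =>
    isDualField_extend (a p) hc₁ hc₂ hf₁_per hf₂_per (flux_mem f₁ f₂ _)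
  have hsi : ∀ p j, IntegrableOn (s p j) column := fun p j => by
    have h1 : MemLp (extend f₁ f₂ (a p) j) 2 (volume.restrict (cell f₁ f₂)) :=
      ((hs p).memLp j).mono_measure (Measure.restrict_mono
        (fun y (hy : y ∈ cell f₁ f₂) => unitSquare_subset_base hy.1) le_rfl)
    have h2 := h1.integrable one_le_two
    rw [restrict_cell hc₁ hc₂] at h2
    exact (integrableOn_iff_integrable_of_support_subset fun y hy => by
      by_contra h
      exact hy ((hs p).eq_zero j y h)).1 h2
  have hζ : ∀ p, MemLp (ζ p) 2 (volume.restrict ω) := fun p =>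
    memLp_coord (hm₀.1.hasWeakDeriv (EuclideanSpace.single p.2 1)).2.1 p.1
  have hflux : ∀ x, flux f₁ f₂ (grad₂ ω m₀ x) = ∑ p, ζ p x • a p := fun x => by
    conv_lhs => rw [Matrix.matrix_eq_sum_single (grad₂ ω m₀ x)]
    simp only [a, ζ, ← map_smul, Matrix.smul_single, smul_eq_mul, mul_one, ← map_sum]
    rw [Fintype.sum_prod_type]
  have hζζ : ∀ p q, Integrable (fun x => ζ p x * ζ q x) (volume.restrict ω) := fun p q =>
    (hζ p).integrable_mul (hζ q)
  have hQi : Integrable (fun x => ‖∑ p, ζ p x • a p‖ ^ 2) (volume.restrict ω) := by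
    simp only [norm_sq_sum_smul]
    exact integrable_finsetSum _ fun p _ => integrable_finsetSum _ fun q _ =>
      (hζζ p q).mul_const _
  have hupper : ∫⁻ x in ω, ENNReal.ofReal (gHom f₁ f₂ (grad₂ ω m₀ x))
      ≤ ENNReal.ofReal (∫ x in ω, ‖∑ p, ζ p x • a p‖ ^ 2) := by
    rw [ofReal_integral_eq_lintegral_ofReal hQi (Eventually.of_forall fun _ => by positivity)]
    refine lintegral_mono fun x => ENNReal.ofReal_le_ofReal ?_
    rw [← hflux]
    exact gHom_le hc₁ hc₂ _
  refine hupper.trans ?_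
  set C : ℝ := ∑ p, ‖a p‖ ^ 2 with hC
  have hC0 : 0 ≤ C := by positivity
  refine ENNReal.le_of_forall_pos_le_add fun τ hτ _ => ?_
  have hδ : 0 < (τ : ℝ) / (6 * (C + 1)) := by positivity
  choose Ψ hΨ hΨc hΨs hΨa using fun p => exists_test_approx hω_open (hζ p) hδ
  have hΨm : ∀ p, MemLp (Ψ p) 2 (volume.restrict ω) := fun p =>
    ((hΨ p).continuous.memLp_of_hasCompactSupport (hΨc p)).restrict ω
  have hlow := ofReal_le_liminf hc₁ hc₂ hf₁_pos hM0 hM hω_open hω_bdd hm₀.1.1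
    (fun ε hε => (hm ε hε).1) hconv hs hsi hΨ hΨc hΨs
  have hdi : ∀ p, Integrable (fun x => (ζ p x - Ψ p x) ^ 2) (volume.restrict ω) := fun p =>
    ((hζ p).sub (hΨm p)).integrable_sq
  have hdQ : Integrable (fun x => ‖∑ p, (ζ p x - Ψ p x) • a p‖ ^ 2) (volume.restrict ω) := by
    simp only [norm_sq_sum_smul]
    exact integrable_finsetSum _ fun p _ => integrable_finsetSum _ fun q _ =>
      (((hζ p).sub (hΨm p)).integrable_mul ((hζ q).sub (hΨm q))).mul_const _
  have herr : ∫ x in ω, ‖∑ p, (ζ p x - Ψ p x) • a p‖ ^ 2 ≤ τ := by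
    calc ∫ x in ω, ‖∑ p, (ζ p x - Ψ p x) • a p‖ ^ 2
        ≤ ∫ x in ω, C * ∑ p, (ζ p x - Ψ p x) ^ 2 :=
          integral_mono hdQ ((integrable_finsetSum _ fun p _ => hdi p).const_mul C) fun x =>
            norm_sq_sum_smul_le _ _
      _ = C * ∑ p, ∫ x in ω, (ζ p x - Ψ p x) ^ 2 := by
          rw [integral_const_mul, integral_finsetSum _ fun p _ => hdi p]
      _ ≤ C * ∑ _p : Fin 3 × Fin 2, (τ : ℝ) / (6 * (C + 1)) := by
          gcongr with p
          exact hΨa p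
      _ ≤ τ := by
          have : C * ∑ _p : Fin 3 × Fin 2, (τ : ℝ) / (6 * (C + 1)) = C * τ / (C + 1) := by
            simp
            field_simp
          rw [this, div_le_iff₀ (by positivity)]
          nlinarith [τ.2]
  have hpair : ∀ p x, ∑ j, inner ℝ (columns (grad₂ ω m₀ x) j) (∫ y in column, s p j y)
      = inner ℝ (∑ q, ζ q x • a q) (a p) := fun p x => by
    rw [← hflux, ← inner_constField hc₁ hc₂]
    exact (inner_orthogonalPart _ _ _).symm
  have hci : ∀ p j, Integrable (fun x => Ψ p x *
      inner ℝ (columns (grad₂ ω m₀ x) j) (∫ y in column, s p j y)) (volume.restrict ω) := by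
    intro p j
    have hcol : ∀ k : Fin 2, Integrable (fun x => Ψ p x * inner ℝ
        (weakDeriv ω m₀ (EuclideanSpace.single k 1) x) (∫ y in column, s p j y))
        (volume.restrict ω) := fun k => by
      have := (integrable_test_smul (hΨ p).continuous (hΨc p)
        (hm₀.1.hasWeakDeriv (EuclideanSpace.single k 1)).2.1).inner_const (𝕜 := ℝ)
          (∫ y in column, s p j y)
      simpa only [real_inner_smul_left] using this
    revert hcol
    generalize (∫ y in column, s p j y) = S
    intro hcol
    fin_cases j
    · exact hcol 0
    · exact hcol 1
    · simp [columns]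
  have hJ : -2 * (∑ p, ∑ j, ∫ x in ω, fderiv ℝ (Ψ p) x (axis j).1 *
        inner ℝ (m₀ x) (∫ y in column, s p j y))
      - ∑ p, ∑ q, (∫ x, Ψ p x * Ψ q x) * ∫ y in column, ∑ j, inner ℝ (s p j y) (s q j y)
      = (∫ x in ω, ‖∑ p, ζ p x • a p‖ ^ 2) - ∫ x in ω, ‖∑ p, (ζ p x - Ψ p x) • a p‖ ^ 2 := by
    have hΨζ : ∀ p, Integrable (fun x => Ψ p x * inner ℝ (∑ q, ζ q x • a q) (a p))
        (volume.restrict ω) := fun p => by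
      simp only [← hpair, Finset.mul_sum]
      exact integrable_finsetSum _ fun j _ => hci p j
    have hΨΨ : ∀ p q, Integrable (fun x => (Ψ p x * Ψ q x) * inner ℝ (a p) (a q))
        (volume.restrict ω) := fun p q => ((hΨm p).integrable_mul (hΨm q)).mul_const _
    rw [← integral_sub hQi hdQ]
    simp only [norm_sq_sub_norm_sq_sum_sub]
    rw [integral_sub ((integrable_finsetSum _ fun p _ => hΨζ p).const_mul 2)
      (integrable_finsetSum _ fun p _ => integrable_finsetSum _ fun q _ => hΨΨ p q),
      integral_const_mul, integral_finsetSum _ fun p _ => hΨζ p,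
      integral_finsetSum _ fun p _ => integrable_finsetSum _ fun q _ => hΨΨ p q]
    simp only [integral_finsetSum Finset.univ fun q (_ : q ∈ Finset.univ) => hΨΨ _ q]
    congr 1
    · simp only [integral_fderiv_inner hm₀.1 (hΨ _) (hΨc _) (hΨs _), Finset.sum_neg_distrib]
      rw [neg_mul_neg]
      congr 1
      refine Finset.sum_congr rfl fun p _ => ?_
      rw [← integral_finsetSum _ fun j _ => hci p j]
      simp only [← hpair, Finset.mul_sum]
    · refine Finset.sum_congr rfl fun p _ => Finset.sum_congr rfl fun q _ => ?_
      rw [integral_inner_extend hc₁ hc₂, integral_mul_const,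
        setIntegral_eq_integral_of_forall_compl_eq_zero]
      intro x hx
      rw [eq_zero_of_notMem (hΨs p) hx, zero_mul]
  rw [hJ] at hlow
  calc ENNReal.ofReal (∫ x in ω, ‖∑ p, ζ p x • a p‖ ^ 2)
      ≤ ENNReal.ofReal (((∫ x in ω, ‖∑ p, ζ p x • a p‖ ^ 2)
          - ∫ x in ω, ‖∑ p, (ζ p x - Ψ p x) • a p‖ ^ 2) + τ) :=
        ENNReal.ofReal_le_ofReal (by linarith)
    _ ≤ _ := by
        refine ENNReal.ofReal_add_le.trans ?_
        rw [ENNReal.ofReal_coe_nnreal]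
        gcongr
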